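/- Let $a\in C^1([-1,1])$ satisfy $a(x)>0$ for all $x\in(-1,1)$, $a(-1)=a(1)=0$, and assume that $A(x)=\int_0^x\frac{ds}{a(s)}$ belongs to $L^1(-1,1)$. Put $$H^1_a(-1,1)=\{u\in L^2(-1,1): u \text{ locally absolutely continuous in }(-1,1),\ \sqrt a\,u_x\in L^2(-1,1)\},$$ and let $A_0u=(au_x)_x$ with domain $$D(A_0)=\{u\in H^1_a(-1,1): au_x\in H^1(-1,1),\ (au_x)(\pm1)=0\}.$$ For $\alpha\in L^\infty(-1,1)$, $v_0\in L^2(-1,1)$ and $S>0$, a weak solution on $[0,S]$ of the Cauchy–Neumann problem $$v_t-(a(x)v_x)_x=\alpha(x)v\ \text{ in }(0,S)\times(-1,1),\qquad a(x)v_x|_{x=\pm1}=0,\qquad v(0,\cdot)=v_0,\tag{P}$$ is a function $v\in C^0([0,S];L^2(-1,1))\cap L^2(0,S;H^1_a(-1,1))$ with $v(0)=v_0$ such that for every $w\in D(A_0)$ the function $t\mapsto\langle v(t),w\rangle_{L^2}$ is absolutely continuous on $[0,S]$ and $\frac{d}{dt}\langle v(t),w\rangle=\langle v(t),A_0w+\alpha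 w\rangle$ for almost every $t\in(0,S)$. Then problem (P) is nonnegatively globally approximately controllable in $L^2(-1,1)$ by means of static controls, and the corresponding solution remains nonnegative. That is, for every $\varepsilon>0$ and all $v_0,v_d\in L^2(-1,1)$ with $v_0\ge0$, $v_d\ge0$ a.e. and $v_0\neq0$, there are a time $T>0$ and a static control $\alpha=\alpha(x)\in L^\infty(-1,1)$ (both depending on $\varepsilon,v_0,v_d$) such that there is a function $v:[0,\infty)\to L^2(-1,1)$ which, for every $S>0$, is on $[0,S]$ the unique weak solution of (P), and which satisfies $$\|v(T,\cdot)-v_d\|_{L^2(-1,1)}\le\varepsilon\qquad\text{and}\qquad v(t,\cdot)\ge0\ \text{ a.e. in }(-1,1)\text{ for every }t\ge0.$$ -/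

import Mathlib

open MeasureTheory Set

namespace DegPar

/-- Lebesgue measure on the interval `(-1, 1)`. -/
noncomputable abbrev mu : Measure ℝ := (volume : Measure ℝ).restrict (Ioo (-1) 1)

/-- The real Hilbert space `L²(-1, 1)`. -/
abbrev L2 : Type := Lp ℝ 2 mu

/-- Standing assumptions on the diffusion coefficient: `a ∈ C¹([-1, 1])`, `a > 0` on `(-1, 1)`,
`a(-1) = a(1) = 0`, and `A(x) = ∫₀ˣ ds / a(s)` belongs to `L¹(-1, 1)`. -/
structure IsCoefficient (a : ℝ → ℝ) : Prop where
  contDiffOn : ContDiffOn ℝ 1 a (Icc (-1) 1)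
  pos : ∀ x ∈ Ioo (-1 : ℝ) 1, 0 < a x
  left : a (-1) = 0
  right : a 1 = 0
  integrable : Integrable (fun x : ℝ => ∫ s in (0 : ℝ)..x, 1 / a s) mu

/-- `f` is locally absolutely continuous in `(-1, 1)`. -/
def LocAC (f : ℝ → ℝ) : Prop :=
  ∀ c d : ℝ, -1 < c → c ≤ d → d < 1 → AbsolutelyContinuousOnInterval f c d

/-- `u ∈ H¹ₐ(-1, 1)` and `√a u_x = p` in `L²(-1, 1)`: the class `u` has a locally absolutely
continuous representative `f`, and `√a f'` is a representative of `p`. -/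
def HasWeightedDeriv (a : ℝ → ℝ) (u p : L2) : Prop :=
  ∃ f : ℝ → ℝ, LocAC f ∧ u =ᵐ[mu] f ∧ p =ᵐ[mu] fun x => √(a x) * deriv f x

/-- `w ∈ D(A₀) = H²ₐ(-1, 1)` and `A₀ w = (a w_x)_x = z` in `L²(-1, 1)`: `w` belongs to `H¹ₐ(-1, 1)`
and the flux `a w_x` belongs to `H¹(-1, 1)`, that is, it agrees a.e. with a function `q` that is
absolutely continuous on `[-1, 1]` and whose derivative is the square integrable function `z`;
moreover the flux vanishes at `±1` (Neumann condition). -/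
def IsDegOp (a : ℝ → ℝ) (w z : L2) : Prop :=
  ∃ f q : ℝ → ℝ,
    LocAC f ∧ w =ᵐ[mu] f ∧ MemLp (fun x => √(a x) * deriv f x) 2 mu ∧
    AbsolutelyContinuousOnInterval q (-1) 1 ∧ q =ᵐ[mu] (fun x => a x * deriv f x) ∧
    q (-1) = 0 ∧ q 1 = 0 ∧ z =ᵐ[mu] deriv q

/-- `v` is the weak solution on the time interval `[0, T]`, in the space
`C⁰([0, T]; L²(-1, 1)) ∩ L²(0, T; H¹ₐ(-1, 1))`, of the Cauchy--Neumann problem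
`v_t - (a v_x)_x = α(t, x) v` in `(0, T) × (-1, 1)`, `a v_x = 0` at `x = ±1`, `v(0, ·) = v₀`.

Weak solutions are tested against the domain of the (self-adjoint) operator `A = A₀ + α`: for every
`w ∈ D(A)`, the function `t ↦ ⟨v(t), w⟩` is absolutely continuous on `[0, T]` and its derivative is
`⟨v(t), A w⟩ = ⟨v(t), A₀ w⟩ + ∫ α(t, x) v(t, x) w(x) dx` for almost every `t`. -/
structure IsWeakSolution (a : ℝ → ℝ) (α : ℝ → ℝ → ℝ) (v₀ : L2) (T : ℝ) (v : ℝ → L2) : Prop where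
  initial : v 0 = v₀
  continuousOn : ContinuousOn v (Icc 0 T)
  /-- `v ∈ L²(0, T; H¹ₐ(-1, 1))`; here `p = √a v_x`. -/
  memH1a : ∃ p : ℝ → L2, MemLp p 2 ((volume : Measure ℝ).restrict (Ioo 0 T)) ∧
    ∀ᵐ t ∂(volume : Measure ℝ).restrict (Ioo 0 T), HasWeightedDeriv a (v t) (p t)
  absolutelyContinuous : ∀ w z : L2, IsDegOp a w z →
    AbsolutelyContinuousOnInterval (fun t => inner ℝ (v t) w) 0 T
  weak_eq : ∀ w z : L2, IsDegOp a w z →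
    ∀ᵐ t ∂(volume : Measure ℝ).restrict (Ioo 0 T),
      HasDerivAt (fun s => inner ℝ (v s) w)
        (inner ℝ (v t) z + ∫ x, α t x * v t x * w x ∂mu) t

end DegPar

/-! The control is designed so that a function close to the target becomes a stationary state.
Approximate `vd` by a positive `C²` function `w` that is constant near `±1`, and take the potential
`-(a w')' / w`, which is bounded and makes `w` a null vector of `A = A₀ + potential`. Picone's
identity writes the energy of `A` as the integral of `a (u' - u w'/w)²`. So `A` is dissipative and
its kernel is exactly the line through `w` (`IsProfile.picone`, `IsProfile.eq_smul_of_mem_kernel`).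

The symmetric contraction semigroup generated by `A` then sends `v₀` to `c w` as `t → ∞`, where `c`
is positive because pairing with `w` is conserved and `v₀ ≥ 0` is nonzero
(`IsSemigroupOf.exists_tendsto`, `IsProfile.inner_pos`). No compactness or spectral gap is needed:
`‖T t x‖²` decreases, and symmetry turns this into the Cauchy property of the orbit. Adding a
constant `δ` to the potential multiplies the orbit by `exp (δ t)`; for a large time `τ` and `exp (δ
τ) = 1 / c` the state is close to `w`, hence to `vd`.

The analytic base is that `B p = ∫₀ˣ p / √a` is bounded on `L²`, because `A ∈ L¹`. Then `H¹ₐ` is the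
constants plus the range of `B`, and the Neumann operator is encoded by `B` and its adjoint
(`isDegOp_iff`). This gives the range condition (`exists_isDegOp_sub_smul_eq`), and a Hille–Yosida
construction gives the semigroup. Nonnegativity passes from the resolvents, where it comes from
testing with `|u| - u` (`resolvent_nonneg`). -/

section AbstractSemigroup

/-! ### Symmetric dissipative graphs and their resolvents. -/

open Filter Topology

variable {H : Type*} [NormedAddCommGroup H] [InnerProductSpace ℝ H]

/-- The graph of a symmetric, dissipative, single-valued operator satisfying the range condition. -/
structure IsDissipativeGraph (G : Submodule ℝ (H × H)) : Prop where
  symm : ∀ x ∈ G, ∀ y ∈ G, inner ℝ x.1 y.2 = inner ℝ x.2 y.1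
  diss : ∀ x ∈ G, inner ℝ x.1 x.2 ≤ 0
  single : ∀ z, ((0 : H), z) ∈ G → z = 0
  range : ∃ h₀ : ℝ, 0 < h₀ ∧ ∀ h, 0 < h → h < h₀ → ∀ f, ∃ x ∈ G, x.1 - h • x.2 = f

/-- `J` is the resolvent `(1 - h A)⁻¹` of the operator `A` with graph `G`. -/
def IsResolventAt (G : Submodule ℝ (H × H)) (h : ℝ) (J : H →L[ℝ] H) : Prop :=
  ∀ f, (J f, h⁻¹ • (J f - f)) ∈ G

variable {G : Submodule ℝ (H × H)}

lemma norm_le_norm_sub_smul_of_inner_nonpos {u z : H} (h : ℝ) (hh : 0 ≤ h)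
    (huz : inner ℝ u z ≤ 0) : ‖u‖ ≤ ‖u - h • z‖ := by
  have h1 : ‖u - h • z‖ ^ 2 = ‖u‖ ^ 2 - 2 * (h * inner ℝ u z) + ‖h • z‖ ^ 2 := by
    rw [norm_sub_sq_real, inner_smul_right]
  have h2 : h * inner ℝ u z ≤ 0 := mul_nonpos_of_nonneg_of_nonpos hh huz
  exact (pow_le_pow_iff_left₀ (norm_nonneg _) (norm_nonneg _) two_ne_zero).mp
    (by nlinarith [sq_nonneg ‖h • z‖])

/-- Dissipativity determines the first component of a solution of `x.1 - h • x.2 = f`, so a solution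
map obtained by choice is automatically linear; the same estimate bounds its norm by `1`. -/
lemma IsDissipativeGraph.exists_resolvent (hG : IsDissipativeGraph G) :
    ∃ h₀ : ℝ, 0 < h₀ ∧ ∀ h, 0 < h → h < h₀ → ∃ J : H →L[ℝ] H, IsResolventAt G h J := by
  obtain ⟨h₀, hh₀, hr⟩ := hG.range
  refine ⟨h₀, hh₀, fun h h0 h1 => ?_⟩
  choose x hxG hx using hr h h0 h1
  have uniq : ∀ y ∈ G, y.1 - h • y.2 = 0 → y.1 = 0 := fun y hy h3 => by
    have := norm_le_norm_sub_smul_of_inner_nonpos h h0.le (hG.diss y hy)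
    rw [h3, norm_zero] at this
    exact norm_le_zero_iff.mp this
  let J₀ : H →ₗ[ℝ] H :=
    { toFun := fun f => (x f).1
      map_add' := fun f g => by
        have := uniq (x (f + g) - x f - x g) (G.sub_mem (G.sub_mem (hxG _) (hxG _)) (hxG _)) (by
          have h1 := hx (f + g)
          have h2 := hx f
          have h3 := hx g
          simp only [Prod.fst_sub, Prod.snd_sub, smul_sub]
          calc _ = ((x (f + g)).1 - h • (x (f + g)).2) - ((x f).1 - h • (x f).2)
                - ((x g).1 - h • (x g).2) := by abel
            _ = 0 := by rw [h1, h2, h3]; abel)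
        simp only [Prod.fst_sub] at this
        rw [sub_sub] at this
        exact sub_eq_zero.mp this
      map_smul' := fun c f => by
        have := uniq (x (c • f) - c • x f) (G.sub_mem (hxG _) (G.smul_mem _ (hxG _))) (by
          have h1 := hx (c • f)
          have h2 := hx f
          simp only [Prod.fst_sub, Prod.snd_sub, smul_sub, Prod.smul_fst, Prod.smul_snd]
          calc _ = ((x (c • f)).1 - h • (x (c • f)).2) - c • ((x f).1 - h • (x f).2) := by
                rw [smul_sub, smul_comm h c]; abel
            _ = 0 := by rw [h1, h2, sub_self])
        simp only [Prod.fst_sub, Prod.smul_fst] at this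
        exact sub_eq_zero.mp this }
  refine ⟨J₀.mkContinuous 1 (fun f => ?_), fun f => ?_⟩
  · have := norm_le_norm_sub_smul_of_inner_nonpos h h0.le (hG.diss _ (hxG f))
    rw [hx f] at this
    simpa [J₀] using this
  · have h2 : h⁻¹ • ((x f).1 - f) = (x f).2 := by
      have h3 : (x f).1 - f = h • (x f).2 := by
        nth_rw 2 [← hx f]
        abel
      rw [h3, smul_smul, inv_mul_cancel₀ h0.ne', one_smul]
    change ((x f).1, h⁻¹ • ((x f).1 - f)) ∈ G
    rw [h2]
    exact hxG f

namespace IsResolventAt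

variable {h k : ℝ} {J K : H →L[ℝ] H}

lemma apply_sub (hJ : IsResolventAt G h J) (hG : IsDissipativeGraph G) (hh : 0 < h) {x z : H}
    (hx : (x, z) ∈ G) : J (x - h • z) = x := by
  have h1 := G.sub_mem (hJ (x - h • z)) hx
  have h2 := norm_le_norm_sub_smul_of_inner_nonpos h hh.le (hG.diss _ h1)
  simp only [Prod.mk_sub_mk] at h2
  rw [smul_sub, smul_smul, mul_inv_cancel₀ hh.ne', one_smul] at h2
  have h3 : J (x - h • z) - x - (J (x - h • z) - (x - h • z) - h • z) = 0 := by abel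
  rw [h3, norm_zero] at h2
  exact sub_eq_zero.mp (norm_le_zero_iff.mp h2)

lemma norm_apply_le (hJ : IsResolventAt G h J) (hG : IsDissipativeGraph G) (hh : 0 < h) (x : H) :
    ‖J x‖ ≤ ‖x‖ := by
  have h2 := norm_le_norm_sub_smul_of_inner_nonpos h hh.le (hG.diss _ (hJ x))
  simp only at h2
  rw [smul_smul, mul_inv_cancel₀ hh.ne', one_smul, sub_sub_cancel] at h2
  exact h2

lemma symm (hJ : IsResolventAt G h J) (hG : IsDissipativeGraph G) (hh : 0 < h) (x y : H) :
    inner ℝ (J x) y = inner ℝ x (J y) := by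
  have h1 := hG.symm _ (hJ x) _ (hJ y)
  simp only [inner_smul_right, inner_smul_left, inner_sub_left, inner_sub_right] at h1
  have h2 := mul_left_cancel₀ (inv_ne_zero hh.ne') h1
  linarith

lemma smul_apply (hJ : IsResolventAt G h J) (hG : IsDissipativeGraph G) (hh : 0 < h) {x z : H}
    (hx : (x, z) ∈ G) : J x - x = h • J z := by
  have h1 := hJ.apply_sub hG hh hx
  rw [map_sub, map_smul] at h1
  nth_rw 2 [← h1]
  abel

lemma inv_smul_apply (hJ : IsResolventAt G h J) (hG : IsDissipativeGraph G) (hh : 0 < h) {x z : H}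
    (hx : (x, z) ∈ G) : h⁻¹ • (J x - x) = J z := by
  rw [hJ.smul_apply hG hh hx, smul_smul, inv_mul_cancel₀ hh.ne', one_smul]

lemma map_mem (hJ : IsResolventAt G h J) (hG : IsDissipativeGraph G) (hh : 0 < h) {x z : H}
    (hx : (x, z) ∈ G) : (J x, J z) ∈ G := by
  rw [← hJ.inv_smul_apply hG hh hx]
  exact hJ x

/-- `J` maps the graph to itself, so `J (K x)` solves the equation that characterizes `K (J x)`. -/
lemma comm (hJ : IsResolventAt G h J) (hK : IsResolventAt G k K) (hG : IsDissipativeGraph G)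
    (hh : 0 < h) (hk : 0 < k) : Commute J K := by
  ext x
  have h1 := hJ.map_mem hG hh (hK x)
  have h2 := hK.apply_sub hG hk h1
  rw [map_smul, smul_smul, mul_inv_cancel₀ hk.ne', one_smul, ← map_sub,
    sub_sub_cancel] at h2
  exact h2.symm

lemma norm_sub_le (hJ : IsResolventAt G h J) (hG : IsDissipativeGraph G) (hh : 0 < h) {x z : H}
    (hx : (x, z) ∈ G) : ‖J x - x‖ ≤ h * ‖z‖ := by
  rw [hJ.smul_apply hG hh hx, norm_smul, Real.norm_of_nonneg hh.le]
  exact mul_le_mul_of_nonneg_left (hJ.norm_apply_le hG hh z) hh.le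

lemma injective (hJ : IsResolventAt G h J) (hG : IsDissipativeGraph G) (hh : 0 < h) {x : H}
    (hx : J x = 0) : x = 0 := by
  have h1 := hJ x
  rw [hx, zero_sub] at h1
  have h2 := hG.single _ h1
  simpa [hh.ne'] using h2

end IsResolventAt

/-- A vector `y` orthogonal to the domain is orthogonal to `J y`; dissipativity at `(J y, h⁻¹ • (J y
- y))` then forces `J y = 0`, and `J` is injective because the graph is single-valued. -/
lemma IsDissipativeGraph.dense_domain [CompleteSpace H] (hG : IsDissipativeGraph G) (x : H) {ε : ℝ}
    (hε : 0 < ε) : ∃ y ∈ G, ‖x - y.1‖ < ε := by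
  have h1 : (G.map (LinearMap.fst ℝ H H)).topologicalClosure = ⊤ := by
    rw [Submodule.topologicalClosure_eq_top_iff, Submodule.eq_bot_iff]
    intro y hy
    obtain ⟨h₀, hh₀, hr⟩ := hG.exists_resolvent
    obtain ⟨J, hJ⟩ := hr (h₀ / 2) (by linarith) (by linarith)
    have hh : 0 < h₀ / 2 := by linarith
    refine hJ.injective hG hh ?_
    have h2 : inner ℝ (J y) y = 0 :=
      (Submodule.mem_orthogonal _ _).mp hy _ ⟨_, hJ y, rfl⟩
    have h3 := hG.diss _ (hJ y)
    simp only [inner_smul_right, inner_sub_right, h2, sub_zero] at h3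
    have h4 : inner ℝ (J y) (J y) ≤ 0 := by
      by_contra hc
      push Not at hc
      have := mul_pos (inv_pos.mpr hh) hc
      linarith
    rw [real_inner_self_eq_norm_sq] at h4
    have : ‖J y‖ = 0 := by nlinarith [norm_nonneg (J y)]
    exact norm_eq_zero.mp this
  have h2 : x ∈ closure ((G.map (LinearMap.fst ℝ H H) : Submodule ℝ H) : Set H) := by
    rw [← Submodule.topologicalClosure_coe, h1]
    trivial
  obtain ⟨y, ⟨w, hw, rfl⟩, hy⟩ := Metric.mem_closure_iff.mp h2 ε hε
  exact ⟨w, hw, by rwa [dist_eq_norm] at hy⟩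

/-! ### Yosida approximations and their exponentials. -/

/-- The Yosida approximation `(J - 1) / h` of an operator with resolvent `J`. -/
noncomputable def yosida (h : ℝ) (J : H →L[ℝ] H) : H →L[ℝ] H := h⁻¹ • (J - 1)

section Exp

variable [CompleteSpace H]

/-- For `t ≥ 0` and `h > 0` this displays the exponential as a power series in `J` with nonnegative
coefficients, which is how contractivity and invariant cones pass from `J` to the semigroup. -/
lemma exp_smul_yosida (h t : ℝ) (J : H →L[ℝ] H) :
    NormedSpace.exp (t • yosida h J) = Real.exp (-(t / h)) • NormedSpace.exp ((t / h) • J) := by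
  let _ : NormedAlgebra ℚ (H →L[ℝ] H) := NormedAlgebra.restrictScalars ℚ ℝ _
  have h1 : t • yosida h J = (t / h) • J + algebraMap ℝ (H →L[ℝ] H) (-(t / h)) := by
    rw [yosida, smul_smul, smul_sub, Algebra.algebraMap_eq_smul_one, neg_smul, sub_eq_add_neg,
      div_eq_mul_inv]
  rw [h1, NormedSpace.exp_add_of_commute (Algebra.commutes _ _).symm,
    ← NormedSpace.algebraMap_exp_comm, Real.exp_eq_exp_ℝ, Algebra.algebraMap_eq_smul_one,
    mul_smul_comm, mul_one]

lemma hasSum_exp_apply (J : H →L[ℝ] H) (s : ℝ) (x : H) :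
    HasSum (fun n : ℕ => ((n.factorial : ℝ)⁻¹ * s ^ n) • (J ^ n) x)
      (NormedSpace.exp (s • J) x) := by
  have h1 := (ContinuousLinearMap.apply ℝ H x).hasSum
    (NormedSpace.exp_series_hasSum_exp' (𝕂 := ℝ) (s • J))
  simpa [smul_pow, smul_smul] using h1

lemma norm_exp_yosida_apply_le {h t : ℝ} {J : H →L[ℝ] H} (hh : 0 < h) (ht : 0 ≤ t)
    (hJ : ∀ x, ‖J x‖ ≤ ‖x‖) (x : H) : ‖NormedSpace.exp (t • yosida h J) x‖ ≤ ‖x‖ := by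
  have hs : 0 ≤ t / h := by positivity
  have hp : ∀ n : ℕ, ‖(J ^ n) x‖ ≤ ‖x‖ := by
    intro n
    induction n with
    | zero => simp
    | succ n ih =>
      rw [pow_succ']
      exact (hJ _).trans ih
  have h1 : ‖NormedSpace.exp ((t / h) • J) x‖ ≤ Real.exp (t / h) * ‖x‖ := by
    have e := NormedSpace.exp_series_hasSum_exp' (𝕂 := ℝ) (t / h)
    rw [← Real.exp_eq_exp_ℝ] at e
    refine (hasSum_exp_apply J (t / h) x).norm_le_of_bounded (e.mul_right ‖x‖) fun n => ?_
    rw [norm_smul, Real.norm_of_nonneg (by positivity), smul_eq_mul]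
    exact mul_le_mul_of_nonneg_left (hp n) (by positivity)
  rw [exp_smul_yosida, smul_apply, norm_smul,
    Real.norm_of_nonneg (Real.exp_pos _).le]
  calc _ ≤ Real.exp (-(t / h)) * (Real.exp (t / h) * ‖x‖) :=
        mul_le_mul_of_nonneg_left h1 (Real.exp_pos _).le
    _ = ‖x‖ := by rw [← mul_assoc, ← Real.exp_add]; simp

lemma exp_yosida_apply_mem {h t : ℝ} {J : H →L[ℝ] H} (hh : 0 < h) (ht : 0 ≤ t) {K : Set H}
    (hK : IsClosed K) (hK0 : (0 : H) ∈ K) (hadd : ∀ x ∈ K, ∀ y ∈ K, x + y ∈ K)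
    (hsmul : ∀ c : ℝ, 0 ≤ c → ∀ x ∈ K, c • x ∈ K) (hJ : ∀ x ∈ K, J x ∈ K) {x : H} (hx : x ∈ K) :
    NormedSpace.exp (t • yosida h J) x ∈ K := by
  have hs : 0 ≤ t / h := by positivity
  have hp : ∀ n : ℕ, (J ^ n) x ∈ K := by
    intro n
    induction n with
    | zero => simpa
    | succ n ih =>
      rw [pow_succ']
      exact hJ _ ih
  rw [exp_smul_yosida, smul_apply]
  refine hsmul _ (Real.exp_pos _).le _ (hK.mem_of_tendsto (hasSum_exp_apply J (t / h) x)
    (Eventually.of_forall fun s => ?_))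
  refine Finset.sum_induction _ (· ∈ K) (fun a b ha hb => hadd a ha b hb) hK0 fun n _ => ?_
  exact hsmul _ (by positivity) _ (hp n)

lemma hasDerivAt_exp_smul_apply (Y : H →L[ℝ] H) (x : H) (t : ℝ) :
    HasDerivAt (fun s : ℝ => NormedSpace.exp (s • Y) x) (NormedSpace.exp (t • Y) (Y x)) t :=
  ((ContinuousLinearMap.apply ℝ H x).hasFDerivAt.comp_hasDerivAt t
    (hasDerivAt_exp_smul_const (𝕂 := ℝ) Y t))

lemma exp_smul_symm {Y : H →L[ℝ] H} (hY : ∀ x y, inner ℝ (Y x) y = inner ℝ x (Y y)) (t : ℝ)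
    (x y : H) : inner ℝ (NormedSpace.exp (t • Y) x) y = inner ℝ x (NormedSpace.exp (t • Y) y) := by
  have hp : ∀ n : ℕ, ∀ x y, inner ℝ ((Y ^ n) x) y = inner ℝ x ((Y ^ n) y) := by
    intro n
    induction n with
    | zero => simp
    | succ n ih =>
      intro x y
      rw [pow_succ]
      change inner ℝ ((Y ^ n) (Y x)) y = _
      rw [ih, hY]
      change inner ℝ x ((Y * Y ^ n) y) = _
      rw [← pow_succ', pow_succ]
  have h1 := (innerSL ℝ y).hasSum (hasSum_exp_apply Y t x)
  have h2 := (innerSL ℝ x).hasSum (hasSum_exp_apply Y t y)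
  simp only [innerSL_apply_apply, inner_smul_right] at h1 h2
  rw [real_inner_comm]
  refine h1.unique ?_
  convert h2 using 3
  rw [real_inner_comm, hp]

/-- Exponentials of two commuting dissipative generators differ by at most `t ‖(Y - Z) x‖`. -/
lemma norm_exp_sub_exp_le {Y Z : H →L[ℝ] H} (hc : Commute Y Z)
    (hY : ∀ t : ℝ, 0 ≤ t → ∀ x, ‖NormedSpace.exp (t • Y) x‖ ≤ ‖x‖)
    (hZ : ∀ t : ℝ, 0 ≤ t → ∀ x, ‖NormedSpace.exp (t • Z) x‖ ≤ ‖x‖) {t : ℝ} (ht : 0 ≤ t) (x : H) :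
    ‖NormedSpace.exp (t • Y) x - NormedSpace.exp (t • Z) x‖ ≤ t * ‖Y x - Z x‖ := by
  let _ : NormedAlgebra ℚ (H →L[ℝ] H) := NormedAlgebra.restrictScalars ℚ ℝ _
  -- The left side is easy to differentiate in `s`; the right side shows that for `0 ≤ s ≤ t` it is
  -- a product of contractions.
  have key : ∀ s : ℝ, NormedSpace.exp (t • Z) * NormedSpace.exp (s • (Y - Z)) =
      NormedSpace.exp ((t - s) • Z) * NormedSpace.exp (s • Y) := by
    intro s
    have c1 : Commute (t • Z) (s • (Y - Z)) :=
      ((hc.symm.sub_right (Commute.refl Z)).smul_right s).smul_left t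
    have c2 : Commute ((t - s) • Z) (s • Y) := (hc.symm.smul_right s).smul_left (t - s)
    rw [← NormedSpace.exp_add_of_commute c1, ← NormedSpace.exp_add_of_commute c2]
    congr 1
    module
  have h1 : ∀ s ∈ Icc (0 : ℝ) t, HasDerivWithinAt
      (fun s : ℝ => NormedSpace.exp (t • Z) (NormedSpace.exp (s • (Y - Z)) x))
      (NormedSpace.exp (t • Z) (NormedSpace.exp (s • (Y - Z)) ((Y - Z) x))) (Icc 0 t) s :=
    fun s _ => ((NormedSpace.exp (t • Z)).hasFDerivAt.comp_hasDerivAt s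
      (hasDerivAt_exp_smul_apply (Y - Z) x s)).hasDerivWithinAt
  have h2 := norm_image_sub_le_of_norm_deriv_le_segment' (C := ‖Y x - Z x‖) h1 (fun s hs => by
    have := congrArg (fun L : H →L[ℝ] H => L ((Y - Z) x)) (key s)
    simp only [mul_apply_eq_comp] at this
    rw [this]
    exact (hZ _ (by linarith [hs.2]) _).trans (hY _ hs.1 _)) t ⟨ht, le_rfl⟩
  have h3 := congrArg (fun L : H →L[ℝ] H => L x) (key t)
  simp only [mul_apply_eq_comp, sub_self, zero_smul, NormedSpace.exp_zero,
    one_apply_eq_self] at h3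
  rw [h3] at h2
  simpa [NormedSpace.exp_zero, mul_comm] using h2

end Exp

end AbstractSemigroup

/-! ### Construction of the contraction semigroup. -/

section AbstractSemigroup

open Filter Topology

variable {H : Type*} [NormedAddCommGroup H] [InnerProductSpace ℝ H] {G : Submodule ℝ (H × H)}

/-- `T` is the contraction semigroup generated by the operator with graph `G`. For convenience
`T t` is the identity for negative `t`. -/
structure IsSemigroupOf (G : Submodule ℝ (H × H)) (T : ℝ → H →L[ℝ] H) : Prop where
  zero : T 0 = 1
  add : ∀ s t, 0 ≤ s → 0 ≤ t → ∀ x, T (s + t) x = T s (T t x)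
  norm_le : ∀ t x, ‖T t x‖ ≤ ‖x‖
  symm : ∀ t x y, inner ℝ (T t x) y = inner ℝ x (T t y)
  mem : ∀ t, ∀ x ∈ G, (T t x.1, T t x.2) ∈ G
  cont : ∀ x, Continuous fun t => T t x
  deriv : ∀ x ∈ G, ∀ t, 0 ≤ t → HasDerivWithinAt (fun s => T s x.1) (T t x.2) (Ici 0) t

/-- Pointwise limits of uniformly bounded operators exist if they exist on a dense set. -/
lemma cauchySeq_of_dense_contraction {E : ℕ → H →L[ℝ] H} (hE : ∀ n x, ‖E n x‖ ≤ ‖x‖)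
    (D : Set H) (hD : ∀ x : H, ∀ ε > 0, ∃ y ∈ D, ‖x - y‖ < ε)
    (hc : ∀ y ∈ D, CauchySeq fun n => E n y) (x : H) : CauchySeq fun n => E n x := by
  rw [Metric.cauchySeq_iff']
  intro ε hε
  obtain ⟨y, hy, hxy⟩ := hD x (ε / 3) (by positivity)
  obtain ⟨N, hN⟩ := Metric.cauchySeq_iff'.mp (hc y hy) (ε / 3) (by positivity)
  refine ⟨N, fun n hn => ?_⟩
  have h1 := hN n hn
  rw [dist_eq_norm] at h1 ⊢
  have h2 : E n x - E N x = E n (x - y) + (E n y - E N y) - E N (x - y) := by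
    simp only [map_sub]; abel
  rw [h2]
  have h3 := hE n (x - y)
  have h4 := hE N (x - y)
  have h5 := norm_sub_le (E n (x - y) + (E n y - E N y)) (E N (x - y))
  have h6 := norm_add_le (E n (x - y)) (E n y - E N y)
  linarith

lemma tendsto_of_dense_contraction {ι : Type*} {l : Filter ι} {E : ι → H →L[ℝ] H} {L : H →L[ℝ] H}
    (hE : ∀ n x, ‖E n x‖ ≤ ‖x‖) (hL : ∀ x, ‖L x‖ ≤ ‖x‖)
    (D : Set H) (hD : ∀ x : H, ∀ ε > 0, ∃ y ∈ D, ‖x - y‖ < ε)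
    (hc : ∀ y ∈ D, Tendsto (fun n => E n y) l (𝓝 (L y))) (x : H) :
    Tendsto (fun n => E n x) l (𝓝 (L x)) := by
  rw [Metric.tendsto_nhds]
  intro ε hε
  obtain ⟨y, hy, hxy⟩ := hD x (ε / 3) (by positivity)
  filter_upwards [Metric.tendsto_nhds.mp (hc y hy) (ε / 3) (by positivity)] with n h1
  rw [dist_eq_norm] at h1 ⊢
  have h2 : E n x - L x = E n (x - y) + (E n y - L y) - L (x - y) := by
    simp only [map_sub]; abel
  rw [h2]
  have h3 := hE n (x - y)
  have h4 := hL (x - y)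
  have h5 := norm_sub_le (E n (x - y) + (E n y - L y)) (L (x - y))
  have h6 := norm_add_le (E n (x - y)) (E n y - L y)
  linarith

/-- **Hille–Yosida theorem** for symmetric dissipative operators. The semigroup preserves every
closed convex cone that the resolvents preserve. -/
theorem IsDissipativeGraph.exists_semigroup [CompleteSpace H] (hG : IsDissipativeGraph G) :
    ∃ T : ℝ → H →L[ℝ] H, IsSemigroupOf G T ∧
      ∀ K : Set H, IsClosed K → (0 : H) ∈ K → (∀ x ∈ K, ∀ y ∈ K, x + y ∈ K) →
        (∀ c : ℝ, 0 ≤ c → ∀ x ∈ K, c • x ∈ K) →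
        (∀ h J, 0 < h → IsResolventAt G h J → ∀ x ∈ K, J x ∈ K) → ∀ t, ∀ x ∈ K, T t x ∈ K := by
  obtain ⟨h₀, hh₀, hres⟩ := hG.exists_resolvent
  -- The offset `2` keeps the step size strictly below `h₀` even for `n = 0`.
  have hlt : ∀ n : ℕ, h₀ / (n + 2) < h₀ := fun n => by
    rw [div_lt_iff₀ (by positivity)]
    nlinarith [(Nat.cast_nonneg n : (0 : ℝ) ≤ n)]
  have hpos : ∀ n : ℕ, 0 < h₀ / ((n : ℝ) + 2) := fun n => by positivity
  choose J hJ using fun n : ℕ => hres (h₀ / (n + 2)) (hpos n) (hlt n)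
  have hdense : ∀ x : H, ∀ ε > 0, ∃ y ∈ {y | ∃ z, (y, z) ∈ G}, ‖x - y‖ < ε := fun x ε hε => by
    obtain ⟨y, hy, hxy⟩ := hG.dense_domain x hε
    exact ⟨y.1, ⟨y.2, hy⟩, hxy⟩
  have hhlim : Tendsto (fun n : ℕ => h₀ / ((n : ℝ) + 2)) atTop (𝓝 0) :=
    tendsto_const_nhds.div_atTop
      (tendsto_atTop_add_const_right _ _ tendsto_natCast_atTop_atTop)
  have hJle : ∀ n x, ‖J n x‖ ≤ ‖x‖ := fun n x => (hJ n).norm_apply_le hG (hpos n) x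
  have hJlim : ∀ x, Tendsto (fun n => J n x) atTop (𝓝 x) := by
    refine tendsto_of_dense_contraction (L := 1) hJle (fun x => le_rfl) _ hdense ?_
    rintro y ⟨z, hz⟩
    refine tendsto_iff_norm_sub_tendsto_zero.mpr (squeeze_zero (fun _ => norm_nonneg _)
      (fun n => (hJ n).norm_sub_le hG (hpos n) hz) ?_)
    simpa using hhlim.mul_const ‖z‖
  set Y : ℕ → H →L[ℝ] H := fun n => yosida (h₀ / (n + 2)) (J n) with hY
  have hYc : ∀ n m, Commute (Y n) (Y m) := fun n m =>
    ((((hJ n).comm (hJ m) hG (hpos n) (hpos m)).sub_left (Commute.one_left _)).sub_right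
      (Commute.one_right _)).smul_left _ |>.smul_right _
  -- On the domain the bounded approximations converge to the generator, since `J n z → z`.
  have hYG : ∀ n, ∀ x z, (x, z) ∈ G → Y n x = J n z := fun n x z hx =>
    (hJ n).inv_smul_apply hG (hpos n) hx
  have hYs : ∀ n x y, inner ℝ (Y n x) y = inner ℝ x (Y n y) := fun n x y => by
    have := (hJ n).symm hG (hpos n) x y
    simp only [hY, yosida, smul_apply, inner_smul_left, inner_smul_right, sub_apply,
      one_apply_eq_self, inner_sub_left, inner_sub_right, this]
    rfl
  have hEle : ∀ n, ∀ t : ℝ, 0 ≤ t → ∀ x, ‖NormedSpace.exp (t • Y n) x‖ ≤ ‖x‖ :=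
    fun n t ht x => norm_exp_yosida_apply_le (hpos n) ht (hJle n) x
  have hdiff : ∀ n m, ∀ t : ℝ, 0 ≤ t → ∀ x z, (x, z) ∈ G →
      ‖NormedSpace.exp (t • Y n) x - NormedSpace.exp (t • Y m) x‖ ≤ t * ‖J n z - J m z‖ :=
    fun n m t ht x z hx => by
      have := norm_exp_sub_exp_le (hYc n m) (hEle n) (hEle m) ht x
      rwa [hYG n x z hx, hYG m x z hx] at this
  have hcau : ∀ t : ℝ, 0 ≤ t → ∀ x, CauchySeq fun n => NormedSpace.exp (t • Y n) x := by
    intro t ht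
    refine cauchySeq_of_dense_contraction (fun n => hEle n t ht) _ hdense ?_
    rintro y ⟨z, hz⟩
    rw [Metric.cauchySeq_iff]
    intro ε hε
    obtain ⟨N, hN⟩ := Metric.cauchySeq_iff.mp (hJlim z).cauchySeq (ε / (t + 1)) (by positivity)
    refine ⟨N, fun m hm n hn => ?_⟩
    have h1 := hN m hm n hn
    rw [dist_eq_norm] at h1 ⊢
    rw [lt_div_iff₀ (by positivity)] at h1
    have h2 := hdiff m n t ht y z hz
    nlinarith [norm_nonneg (J m z - J n z)]
  -- Truncating time at `0` makes the family total while every contraction estimate stays valid.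
  have hlim : ∀ t : ℝ, ∃ L : H →L[ℝ] H, ∀ x,
      Tendsto (fun n => NormedSpace.exp (max t 0 • Y n) x) atTop (𝓝 (L x)) := by
    intro t
    choose L hL using fun x => cauchySeq_tendsto_of_complete (hcau (max t 0) (le_max_right _ _) x)
    refine ⟨LinearMap.mkContinuous
      { toFun := L
        map_add' := fun x y => tendsto_nhds_unique (hL (x + y)) (by
          simpa only [map_add] using (hL x).add (hL y))
        map_smul' := fun c x => tendsto_nhds_unique (hL (c • x)) (by
          simpa only [map_smul, RingHom.id_apply] using (hL x).const_smul c) } 1 (fun x => ?_), hL⟩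
    rw [one_mul]
    exact le_of_tendsto (hL x).norm
      (Eventually.of_forall fun n => hEle n _ (le_max_right _ _) x)
  choose T hT using hlim
  have hT' : ∀ t, 0 ≤ t → ∀ x, Tendsto (fun n => NormedSpace.exp (t • Y n) x) atTop (𝓝 (T t x)) :=
    fun t ht x => by simpa only [max_eq_left ht] using hT t x
  have hTle : ∀ t x, ‖T t x‖ ≤ ‖x‖ := fun t x => le_of_tendsto (hT t x).norm
      (Eventually.of_forall fun n => hEle n _ (le_max_right _ _) x)
  have hTsymm : ∀ t x y, inner ℝ (T t x) y = inner ℝ x (T t y) := fun t x y => by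
    refine tendsto_nhds_unique ((hT t x).inner (tendsto_const_nhds (x := y))) ?_
    have := (tendsto_const_nhds (x := x)).inner (𝕜 := ℝ) (hT t y)
    refine this.congr fun n => (exp_smul_symm (hYs n) _ x y).symm
  have hTJ : ∀ t n x, T t (J n x) = J n (T t x) := fun t n x => by
    refine tendsto_nhds_unique (hT t (J n x))
      ((((J n).continuous.tendsto _).comp (hT t x)).congr fun m => ?_)
    have c0 : Commute (J n) (Y m) :=
      (((hJ n).comm (hJ m) hG (hpos n) (hpos m)).sub_right (Commute.one_right _)).smul_right _
    have c1 := (c0.smul_right (max t 0)).exp_right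
    exact congrArg (fun L : H →L[ℝ] H => L x) c1.eq
  -- Write `x = J (x - h • z)` with `J = J 0` and use that `T t` commutes with `J`.
  have hmem : ∀ t, ∀ x ∈ G, (T t x.1, T t x.2) ∈ G := by
    rintro t ⟨x, z⟩ hx
    have h1 := (hJ 0).apply_sub hG (hpos 0) hx
    have h2 := (hJ 0) (T t (x - (h₀ / ((0 : ℕ) + 2)) • z))
    rw [← hTJ, h1, map_sub, sub_sub_cancel, map_smul, smul_smul, inv_mul_cancel₀ (hpos 0).ne',
      one_smul] at h2
    exact h2
  have hrate : ∀ n t x z, (x, z) ∈ G →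
      ‖NormedSpace.exp (max t 0 • Y n) x - T t x‖ ≤ max t 0 * ‖J n z - z‖ := by
    intro n t x z hx
    refine le_of_tendsto_of_tendsto ((tendsto_const_nhds.sub (hT t x)).norm)
      ((tendsto_const_nhds.sub (hJlim z)).norm.const_mul _) (Eventually.of_forall fun m => ?_)
    exact hdiff n m _ (le_max_right _ _) x z hx
  have hcE : ∀ n x, Continuous fun t : ℝ => NormedSpace.exp (max t 0 • Y n) x := fun n x => by
    have : Continuous fun t : ℝ => NormedSpace.exp (t • Y n) x :=
      continuous_iff_continuousAt.mpr fun t =>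
        (hasDerivAt_exp_smul_apply (Y n) x t).continuousAt
    exact this.comp (continuous_id.max continuous_const)
  have hcont : ∀ x, Continuous fun t => T t x := by
    intro x
    rw [continuous_iff_continuousAt]
    intro t
    refine tendsto_of_dense_contraction (E := T) (L := T t) hTle (hTle t) _ hdense ?_ x
    rintro y ⟨z, hz⟩
    have hloc : TendstoLocallyUniformly (fun n t => NormedSpace.exp (max t 0 • Y n) y)
        (fun t => T t y) atTop := by
      rw [Metric.tendstoLocallyUniformly_iff]
      intro ε hε t₀
      refine ⟨Iio (t₀ + 1), Iio_mem_nhds (by linarith), ?_⟩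
      have h1 : Tendsto (fun n => (|t₀| + 1) * ‖J n z - z‖) atTop (𝓝 0) := by
        simpa using (tendsto_iff_norm_sub_tendsto_zero.mp (hJlim z)).const_mul (|t₀| + 1)
      filter_upwards [h1.eventually (gt_mem_nhds hε)] with n hn s hs
      rw [dist_comm, dist_eq_norm]
      refine (hrate n s y z hz).trans_lt (lt_of_le_of_lt ?_ hn)
      refine mul_le_mul_of_nonneg_right ?_ (norm_nonneg _)
      have hs' : s < t₀ + 1 := hs
      exact max_le (by linarith [le_abs_self t₀]) (by positivity)
    exact (hloc.continuous (Frequently.of_forall fun n => hcE n y)).continuousAt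
  -- Derivatives do not pass to the limit directly, but the integrated equation does, by dominated
  -- convergence; the derivative is then recovered from the continuity of `s ↦ T s z`.
  have hint : ∀ t, 0 ≤ t → ∀ x z, (x, z) ∈ G → T t x - x = ∫ s in (0 : ℝ)..t, T s z := by
    intro t ht x z hx
    have h1 : ∀ n, NormedSpace.exp (t • Y n) x - x =
        ∫ s in (0 : ℝ)..t, NormedSpace.exp (max s 0 • Y n) (J n z) := by
      intro n
      have h2 := intervalIntegral.integral_eq_sub_of_hasDerivAt
        (f := fun s : ℝ => NormedSpace.exp (s • Y n) x) (a := 0) (b := t)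
        (fun s _ => hasDerivAt_exp_smul_apply (Y n) x s)
        (Continuous.intervalIntegrable (continuous_iff_continuousAt.mpr fun s =>
          (hasDerivAt_exp_smul_apply (Y n) (Y n x) s).continuousAt) _ _)
      simp only [zero_smul, NormedSpace.exp_zero, one_apply_eq_self] at h2
      rw [← h2]
      refine intervalIntegral.integral_congr fun s hs => ?_
      rw [uIcc_of_le ht] at hs
      simp only [max_eq_left hs.1, hYG n x z hx]
    refine tendsto_nhds_unique ((hT' t ht x).sub_const x) ?_
    simp_rw [h1]
    refine intervalIntegral.tendsto_integral_filter_of_dominated_convergence (fun _ => ‖z‖)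
      (Eventually.of_forall fun n => (hcE n (J n z)).aestronglyMeasurable)
      (Eventually.of_forall fun n => Eventually.of_forall fun s _ =>
        (hEle n _ (le_max_right _ _) _).trans (hJle n z))
      intervalIntegrable_const (Eventually.of_forall fun s _ => ?_)
    have h3 : Tendsto (fun n => NormedSpace.exp (max s 0 • Y n) (J n z - z)) atTop (𝓝 0) :=
      squeeze_zero_norm (fun n => hEle n _ (le_max_right _ _) _)
        (tendsto_iff_norm_sub_tendsto_zero.mp (hJlim z))
    simpa using h3.add (hT s z)
  refine ⟨T, ⟨?_, ?_, hTle, hTsymm, hmem, hcont, ?_⟩, ?_⟩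
  · ext x
    refine tendsto_nhds_unique (hT' 0 le_rfl x) ?_
    simp [NormedSpace.exp_zero]
  · intro s t hs ht x
    refine tendsto_nhds_unique (hT' (s + t) (add_nonneg hs ht) x) ?_
    have h3 : Tendsto (fun n => NormedSpace.exp (s • Y n)
        (NormedSpace.exp (t • Y n) x - T t x)) atTop (𝓝 0) :=
      squeeze_zero_norm (fun n => hEle n _ hs _)
        (tendsto_iff_norm_sub_tendsto_zero.mp (hT' t ht x))
    have h4 := h3.add (hT' s hs (T t x))
    rw [zero_add] at h4
    refine h4.congr fun n => ?_
    let _ : NormedAlgebra ℚ (H →L[ℝ] H) := NormedAlgebra.restrictScalars ℚ ℝ _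
    rw [add_smul, NormedSpace.exp_add_of_commute
      (((Commute.refl (Y n)).smul_left s).smul_right t), mul_apply_eq_comp, map_sub,
      sub_add_cancel]
  · rintro ⟨x, z⟩ hx t ht
    have h1 : HasDerivAt (fun t => x + ∫ s in (0 : ℝ)..t, T s z) (T t z) t :=
      ((hcont z).integral_hasStrictDerivAt 0 t).hasDerivAt.const_add x
    refine h1.hasDerivWithinAt.congr (fun s hs => ?_) ?_
    · simp [← hint s hs x z hx]
    · simp [← hint t ht x z hx]
  · intro K hK hK0 hadd hsmul hJK t x hx
    exact hK.mem_of_tendsto (hT t x) (Eventually.of_forall fun n =>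
      exp_yosida_apply_mem (hpos n) (le_max_right _ _) hK hK0 hadd hsmul
        (hJK _ _ (hpos n) (hJ n)) hx)

end AbstractSemigroup

/-! ### Long-time limits, weak uniqueness and energy regularity of orbits. -/

section AbstractSemigroup

open Filter Topology

variable {H : Type*} [NormedAddCommGroup H] [InnerProductSpace ℝ H] {G : Submodule ℝ (H × H)}
  {T : ℝ → H →L[ℝ] H}

lemma IsSemigroupOf.apply_of_mem_kernel (hT : IsSemigroupOf G T) {w : H} (hw : (w, 0) ∈ G) {t : ℝ}
    (ht : 0 ≤ t) : T t w = w := by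
  have h1 := norm_image_sub_le_of_norm_deriv_le_segment' (f := fun s => T s w) (C := 0)
    (f' := fun _ => 0) (a := 0) (b := t) (fun s hs => by
      have : HasDerivWithinAt (fun s => T s w) (T s 0) (Icc 0 t) s :=
        (hT.deriv _ hw s hs.1).mono Icc_subset_Ici_self
      simpa using this) (by simp) t ⟨ht, le_rfl⟩
  simp only [zero_mul, hT.zero, one_apply_eq_self] at h1
  exact sub_eq_zero.mp (norm_le_zero_iff.mp h1)

lemma IsSemigroupOf.norm_antitone (hT : IsSemigroupOf G T) {s t : ℝ} (hs : 0 ≤ s) (hst : s ≤ t)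
    (x : H) : ‖T t x‖ ≤ ‖T s x‖ := by
  have := hT.add (t - s) s (by linarith) hs x
  rw [sub_add_cancel] at this
  rw [this]
  exact hT.norm_le _ _

/-- By symmetry both sides equal `⟨x, T (s + t) x⟩`. This turns convergence of norms into
convergence of orbits. -/
lemma IsSemigroupOf.inner_apply_apply (hT : IsSemigroupOf G T) {s t : ℝ} (hs : 0 ≤ s) (ht : 0 ≤ t)
    (x : H) : inner ℝ (T s x) (T t x) = ‖T ((s + t) / 2) x‖ ^ 2 := by
  rw [← real_inner_self_eq_norm_sq, hT.symm s, hT.symm ((s + t) / 2), ← hT.add _ _ hs ht,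
    ← hT.add _ _ (by positivity) (by positivity), add_halves]

/-- Orbits of a symmetric contraction semigroup converge to elements of the kernel. -/
theorem IsSemigroupOf.exists_tendsto [CompleteSpace H] (hT : IsSemigroupOf G T)
    (hG : IsDissipativeGraph G) (x : H) :
    ∃ y, (y, 0) ∈ G ∧ Tendsto (fun t => T t x) atTop (𝓝 y) := by
  have hbdd : BddBelow ((fun t => ‖T t x‖ ^ 2) '' Ici 0) :=
    ⟨0, by rintro _ ⟨t, _, rfl⟩; positivity⟩
  set L := sInf ((fun t => ‖T t x‖ ^ 2) '' Ici 0) with hL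
  have hLle : ∀ t, 0 ≤ t → L ≤ ‖T t x‖ ^ 2 := fun t ht => csInf_le hbdd ⟨t, ht, rfl⟩
  have hc : Cauchy (map (fun t => T t x) atTop) := by
    rw [← CauchySeq, Metric.cauchySeq_iff]
    intro ε hε
    -- For `s, t ≥ N` both squared norms are below `L + ε² / 2`, while the mixed term is at least
    -- `L`, so `‖T s x - T t x‖² < ε²`.
    obtain ⟨_, ⟨N, hN, rfl⟩, hNL⟩ := exists_lt_of_csInf_lt
      (s := (fun t => ‖T t x‖ ^ 2) '' Ici 0) ⟨_, 0, self_mem_Ici, rfl⟩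
      (show sInf _ < L + ε ^ 2 / 2 by rw [← hL]; linarith [sq_pos_of_pos hε])
    have hN0 : (0 : ℝ) ≤ N := hN
    refine ⟨N, fun s hs t ht => ?_⟩
    have hs0 : 0 ≤ s := hN0.trans hs
    have ht0 : 0 ≤ t := hN0.trans ht
    rw [dist_eq_norm]
    refine lt_of_pow_lt_pow_left₀ 2 hε.le ?_
    rw [norm_sub_sq_real, hT.inner_apply_apply hs0 ht0]
    have h1 := hLle ((s + t) / 2) (by positivity)
    have h2 := pow_le_pow_left₀ (norm_nonneg _) (hT.norm_antitone hN0 hs x) 2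
    have h3 := pow_le_pow_left₀ (norm_nonneg _) (hT.norm_antitone hN0 ht x) 2
    simp only at hNL
    linarith
  obtain ⟨y, hy⟩ := cauchy_map_iff_exists_tendsto.mp hc
  refine ⟨y, ?_, hy⟩
  have hfix : ∀ s, 0 ≤ s → T s y = y := by
    intro s hs
    refine tendsto_nhds_unique (((T s).continuous.tendsto y).comp hy) ?_
    have h1 : Tendsto (fun t => T (s + t) x) atTop (𝓝 y) :=
      hy.comp (tendsto_atTop_add_const_left _ _ tendsto_id)
    refine h1.congr' ?_
    filter_upwards [eventually_ge_atTop 0] with t ht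
    exact hT.add s t hs ht x
  obtain ⟨h₀, hh₀, hr⟩ := hG.exists_resolvent
  have hh : 0 < h₀ / 2 := by linarith
  obtain ⟨J, hJ⟩ := hr (h₀ / 2) hh (by linarith)
  have hTJ : ∀ s, 0 ≤ s → T s (J y) = J y := by
    intro s hs
    have h1 := hJ.apply_sub hG hh (hT.mem s _ (hJ y))
    simp only at h1
    rw [← map_smul, ← map_sub, smul_smul, mul_inv_cancel₀ hh.ne', one_smul, sub_sub_cancel,
      hfix s hs] at h1
    exact h1.symm
  -- `J y` lies in the domain and is fixed by the semigroup, so the generator annihilates it; its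
  -- image there is `h⁻¹ • (J y - y)`, whence `J y = y`.
  have h2 : HasDerivWithinAt (fun s => T s (J y)) 0 (Ici 0) 0 :=
    (hasDerivWithinAt_const (0 : ℝ) (Ici 0) (J y)).congr (fun s hs => hTJ s hs) (hTJ 0 le_rfl)
  have h3 := (uniqueDiffOn_Ici (0 : ℝ) 0 self_mem_Ici).eq_deriv _ h2 (hT.deriv _ (hJ y) 0 le_rfl)
  rw [hT.zero, one_apply_eq_self] at h3
  simp only at h3
  have h4 := hJ y
  rw [← h3] at h4
  have h5 : J y = y := by
    have := h3.symm
    rwa [smul_eq_zero_iff_right (inv_ne_zero hh.ne'), sub_eq_zero] at this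
  rwa [h5] at h4

/-- Uniqueness of weak solutions of `z' = (A + δ) z`, `z(0) = 0`. -/
theorem IsDissipativeGraph.eq_zero_of_weak [CompleteSpace H] (hG : IsDissipativeGraph G)
    {S δ : ℝ} (hS : 0 < S) {z : ℝ → H} (hz0 : z 0 = 0) (hzc : ContinuousOn z (Icc 0 S))
    (hac : ∀ x ∈ G, AbsolutelyContinuousOnInterval (fun t => inner ℝ (z t) x.1) 0 S)
    (hd : ∀ x ∈ G, ∀ᵐ t ∂(volume : Measure ℝ).restrict (Ioo 0 S),
      HasDerivAt (fun s => inner ℝ (z s) x.1) (inner ℝ (z t) x.2 + δ * inner ℝ (z t) x.1) t) :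
    ∀ t ∈ Icc 0 S, z t = 0 := by
  obtain ⟨h₀, hh₀, hr⟩ := hG.exists_resolvent
  have hh : 0 < h₀ / 2 := by linarith
  obtain ⟨J, hJ⟩ := hr (h₀ / 2) hh (by linarith)
  set h := h₀ / 2
  set ζ : ℝ → H := IccExtend hS.le ((Icc 0 S).domRestrict z) with hζ
  have hζc : Continuous ζ := (continuousOn_iff_continuous_domRestrict.mp hzc).Icc_extend'
  have hζz : ∀ t ∈ Icc 0 S, ζ t = z t := fun t ht => by
    rw [hζ, IccExtend_of_mem _ _ ht]; rfl
  set F : ℝ → H := fun t => h⁻¹ • (J (ζ t) - ζ t) + δ • J (ζ t) with hF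
  have hFc : Continuous F := by fun_prop
  set Y : ℝ → H := fun t => ∫ s in (0 : ℝ)..t, F s with hY
  have hYd : ∀ t, HasDerivAt Y (F t) t := fun t => (hFc.integral_hasStrictDerivAt 0 t).hasDerivAt
  -- Testing the weak equation with `J ψ` for arbitrary `ψ` shows that `J z` solves a genuine
  -- differential equation with the continuous right-hand side `F`.
  have hYz : ∀ t ∈ Icc 0 S, Y t = J (z t) := by
    intro t ht
    refine ext_inner_right ℝ fun ψ => ?_
    have hac1 := (hac _ (hJ ψ)).mono (c := 0) (d := t) (by
      rw [uIcc_of_le ht.1, uIcc_of_le hS.le]; exact Icc_subset_Icc_right ht.2)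
    have h1 := hac1.integral_deriv_eq_sub
    simp only [hz0, inner_zero_left, sub_zero] at h1
    rw [hJ.symm hG hh, ← h1, hY]
    rw [real_inner_comm, ← innerSL_apply_apply ℝ,
      ← ContinuousLinearMap.intervalIntegral_comp_comm _ (hFc.intervalIntegrable _ _)]
    refine intervalIntegral.integral_congr_ae ?_
    have h2 := hd _ (hJ ψ)
    rw [ae_restrict_iff' measurableSet_Ioo] at h2
    have h3 : ∀ᵐ s : ℝ, s ≠ S := by simp [ae_iff, measure_singleton]
    filter_upwards [h2, h3] with s hs hsS hst
    rw [uIoc_of_le ht.1] at hst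
    have hs1 : s ∈ Ioo 0 S := ⟨hst.1, lt_of_le_of_ne (hst.2.trans ht.2) hsS⟩
    rw [(hs hs1).deriv, innerSL_apply_apply, hF]
    simp only
    rw [hζz s (Ioo_subset_Icc_self hs1), real_inner_comm]
    simp only [inner_add_left, inner_smul_left, inner_smul_right, inner_sub_left, inner_sub_right,
      hJ.symm hG hh]
    rfl
  -- The exponential weight cancels the `δ` term, leaving twice the dissipative pairing at `J z`,
  -- which is nonpositive.
  have hanti : AntitoneOn (fun t => Real.exp (-(2 * δ) * t) * ‖Y t‖ ^ 2) (Icc 0 S) := by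
    have hder : ∀ t, HasDerivAt (fun t => Real.exp (-(2 * δ) * t) * ‖Y t‖ ^ 2)
        (Real.exp (-(2 * δ) * t) * (-(2 * δ)) * ‖Y t‖ ^ 2 +
          Real.exp (-(2 * δ) * t) * (2 * inner ℝ (Y t) (F t))) t := by
      intro t
      refine HasDerivAt.mul ?_ (hYd t).norm_sq
      have := ((hasDerivAt_id t).const_mul (-(2 * δ))).exp
      simpa using this
    refine antitoneOn_of_deriv_nonpos (convex_Icc _ _)
      (continuous_iff_continuousAt.mpr fun t => (hder t).continuousAt).continuousOn
      (fun t _ => (hder t).differentiableAt.differentiableWithinAt) fun t ht => ?_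
    rw [interior_Icc] at ht
    have ht' := Ioo_subset_Icc_self ht
    have h4 := hG.diss _ (hJ (z t))
    simp only at h4
    rw [(hder t).deriv, hF, hYz t ht']
    simp only [hζz t ht', inner_add_right]
    rw [inner_smul_right _ _ δ, real_inner_self_eq_norm_sq]
    have h5 := mul_nonpos_of_nonneg_of_nonpos (Real.exp_pos (-(2 * δ) * t)).le h4
    linarith
  intro t ht
  have h6 := hanti ⟨le_rfl, hS.le⟩ ht ht.1
  have h7 : Y 0 = 0 := by simp [hY]
  simp only [h7, norm_zero] at h6
  have h8 : ‖Y t‖ ^ 2 ≤ 0 := by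
    by_contra hc
    push Not at hc
    have := mul_pos (Real.exp_pos (-(2 * δ) * t)) hc
    rw [zero_pow two_ne_zero, mul_zero] at h6
    linarith
  have h9 : Y t = 0 := by
    have : ‖Y t‖ = 0 := by nlinarith [norm_nonneg (Y t)]
    exact norm_eq_zero.mp this
  rw [hYz t ht] at h9
  exact hJ.injective hG hh h9

/-- If the energy of a generator controls a quantity `P`, then `P` extends to a square integrable
function of time along arbitrary orbits. -/
theorem IsSemigroupOf.exists_memLp [CompleteSpace H] (hT : IsSemigroupOf G T)
    (hG : IsDissipativeGraph G) (P : H × H →L[ℝ] H) {V : Set (H × H)} (hV : IsClosed V) {C : ℝ}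
    (hC : 0 ≤ C)
    (hPV : ∀ x ∈ G, (x.1, P x) ∈ V)
    (hP : ∀ x ∈ G, ‖P x‖ ^ 2 ≤ -inner ℝ x.1 x.2 + C * ‖x.1‖ ^ 2) (x₀ : H) {S : ℝ} (hS : 0 < S) :
    ∃ p : ℝ → H, MemLp p 2 ((volume : Measure ℝ).restrict (Ioo 0 S)) ∧
      ∀ᵐ t ∂(volume : Measure ℝ).restrict (Ioo 0 S), (T t x₀, p t) ∈ V := by
  set ν := (volume : Measure ℝ).restrict (Ioo 0 S) with hν
  set Q : H × H → ℝ → H := fun x t => P (T t x.1, T t x.2) with hQ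
  have hQc : ∀ x, Continuous (Q x) := fun x =>
    P.continuous.comp ((hT.cont x.1).prodMk (hT.cont x.2))
  have hQmem : ∀ x, MemLp (Q x) 2 ν := by
    intro x
    obtain ⟨b, hb⟩ := (isCompact_Icc (a := (0 : ℝ)) (b := S)).exists_bound_of_continuousOn
      (hQc x).continuousOn
    refine MemLp.of_bound (hQc x).aestronglyMeasurable b ?_
    filter_upwards [ae_restrict_mem measurableSet_Ioo] with t ht
    exact hb t (Ioo_subset_Icc_self ht)
  -- Integrate `d/dt ‖T t x‖² = 2 ⟨T t x, T t z⟩` over `[0, S]`. The bound involves only `‖x.1‖`, so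
  -- it survives approximation of an arbitrary initial state.
  have hen : ∀ x ∈ G, ∫ t, ‖Q x t‖ ^ 2 ∂ν ≤ (1 / 2 + C * S) * ‖x.1‖ ^ 2 := by
    intro x hx
    have hci : Continuous fun t => inner ℝ (T t x.1) (T t x.2) :=
      (hT.cont x.1).inner (hT.cont x.2)
    have h1 : ∫ t in (0 : ℝ)..S, 2 * inner ℝ (T t x.1) (T t x.2) = ‖T S x.1‖ ^ 2 - ‖x.1‖ ^ 2 := by
      have := intervalIntegral.integral_eq_sub_of_hasDeriv_right_of_le (a := 0) (b := S) hS.le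
        (f := fun t => ‖T t x.1‖ ^ 2) (f' := fun t => 2 * inner ℝ (T t x.1) (T t x.2))
        ((hT.cont x.1).norm.pow 2).continuousOn
        (fun t ht => ((hT.deriv x hx t ht.1.le).mono (fun s hs => ht.1.le.trans
          (le_of_lt hs) : Ioi t ⊆ Ici 0)).norm_sq)
        ((hci.const_mul 2).intervalIntegrable _ _)
      simpa [hT.zero] using this
    rw [hν, ← integral_Ioc_eq_integral_Ioo, ← intervalIntegral.integral_of_le hS.le]
    calc ∫ t in (0 : ℝ)..S, ‖Q x t‖ ^ 2
        ≤ ∫ t in (0 : ℝ)..S, (-(1 / 2) * (2 * inner ℝ (T t x.1) (T t x.2)) + C * ‖x.1‖ ^ 2) := by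
          refine intervalIntegral.integral_mono_on hS.le
            (((hQc x).norm.pow 2).intervalIntegrable _ _)
            ((((hci.const_mul 2).const_mul _).add continuous_const).intervalIntegrable _ _)
            fun t ht => ?_
          have h2 := hP _ (hT.mem t x hx)
          have h3 := pow_le_pow_left₀ (norm_nonneg _) (hT.norm_le t x.1) 2
          have h4 := mul_le_mul_of_nonneg_left h3 hC
          simp only at h2
          change ‖P (T t x.1, T t x.2)‖ ^ 2 ≤ _
          linarith
      _ = -(1 / 2) * (‖T S x.1‖ ^ 2 - ‖x.1‖ ^ 2) + S * (C * ‖x.1‖ ^ 2) := by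
          rw [intervalIntegral.integral_add (((hci.const_mul 2).const_mul _).intervalIntegrable _ _)
            intervalIntegrable_const, intervalIntegral.integral_const_mul, h1,
            intervalIntegral.integral_const]
          simp
      _ ≤ _ := by nlinarith [sq_nonneg ‖T S x.1‖]
  have hnorm : ∀ x ∈ G, ‖(hQmem x).toLp‖ ^ 2 ≤ (1 / 2 + C * S) * ‖x.1‖ ^ 2 := by
    intro x hx
    rw [← real_inner_self_eq_norm_sq, L2.inner_def]
    refine le_trans (le_of_eq ?_) (hen x hx)
    refine integral_congr_ae ?_
    filter_upwards [(hQmem x).coeFn_toLp] with t ht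
    rw [ht, real_inner_self_eq_norm_sq]
  have hseq : ∀ n : ℕ, ∃ y ∈ G, ‖x₀ - y.1‖ < 1 / ((n : ℝ) + 1) := fun n =>
    hG.dense_domain x₀ (by positivity)
  choose x hxG hx using hseq
  have hx1 : Tendsto (fun n => (x n).1) atTop (𝓝 x₀) := by
    rw [tendsto_iff_norm_sub_tendsto_zero]
    refine squeeze_zero (fun _ => norm_nonneg _) (fun n => ?_)
      tendsto_one_div_add_atTop_nhds_zero_nat
    rw [norm_sub_rev]
    exact (hx n).le
  set M := √(1 / 2 + C * S) + 1 with hM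
  have hMpos : 0 < M := by positivity
  have hdiff : ∀ n m, ‖(hQmem (x n)).toLp - (hQmem (x m)).toLp‖ ≤ M * ‖(x n).1 - (x m).1‖ := by
    intro n m
    have h1 : (hQmem (x n)).toLp - (hQmem (x m)).toLp = (hQmem (x n - x m)).toLp := by
      rw [← MemLp.toLp_sub]
      congr 1
      ext t
      simp only [hQ, Pi.sub_apply, Prod.fst_sub, Prod.snd_sub, map_sub, ← Prod.mk_sub_mk]
    rw [h1]
    refine (pow_le_pow_iff_left₀ (norm_nonneg _) (by positivity) two_ne_zero).mp ?_
    refine (hnorm _ (G.sub_mem (hxG n) (hxG m))).trans ?_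
    rw [mul_pow, Prod.fst_sub]
    refine mul_le_mul_of_nonneg_right ?_ (sq_nonneg _)
    have h0 : 0 ≤ 1 / 2 + C * S := by positivity
    nlinarith [Real.sq_sqrt h0, Real.sqrt_nonneg (1 / 2 + C * S)]
  have hcau : CauchySeq fun n => (hQmem (x n)).toLp := by
    rw [Metric.cauchySeq_iff]
    intro ε hε
    obtain ⟨N, hN⟩ := Metric.cauchySeq_iff.mp hx1.cauchySeq (ε / M) (by positivity)
    refine ⟨N, fun m hm n hn => ?_⟩
    have h1 := hN m hm n hn
    rw [dist_eq_norm, lt_div_iff₀ hMpos] at h1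
    rw [dist_eq_norm]
    linarith [hdiff m n]
  obtain ⟨f, hf⟩ := cauchySeq_tendsto_of_complete hcau
  -- Almost everywhere convergence along a subsequence lets the closed relation `V` be passed to the
  -- limit at almost every time.
  obtain ⟨ns, hns, hae⟩ := (tendstoInMeasure_of_tendsto_Lp hf).exists_seq_tendsto_ae
  refine ⟨f, Lp.memLp f, ?_⟩
  have hco : ∀ᵐ t ∂ν, ∀ n, ((hQmem (x n)).toLp : ℝ → H) t = Q (x n) t :=
    ae_all_iff.mpr fun n => (hQmem (x n)).coeFn_toLp
  filter_upwards [hae, hco] with t ht hQt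
  refine hV.mem_of_tendsto (f := fun n => (T t (x (ns n)).1, Q (x (ns n)) t)) (b := atTop) ?_
    (Eventually.of_forall fun n => hPV _ (hT.mem t _ (hxG (ns n))))
  refine Tendsto.prodMk_nhds ?_ (by simpa only [hQt] using ht)
  exact ((T t).continuous.tendsto x₀).comp (hx1.comp hns.tendsto_atTop)

end AbstractSemigroup

/-! ### The space `L²(-1, 1)` and the weighted primitive. -/

namespace DegPar

open Filter Topology

variable {a : ℝ → ℝ}

/-! ### Preliminaries on `L²(-1, 1)` -/

lemma inner_eq_integral (u v : L2) : inner ℝ u v = ∫ x, u x * v x ∂mu := by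
  rw [L2.inner_def]
  exact integral_congr_ae (Eventually.of_forall fun x => by simp [mul_comm])

lemma norm_sq_eq_integral (u : L2) : ‖u‖ ^ 2 = ∫ x, u x ^ 2 ∂mu := by
  rw [← real_inner_self_eq_norm_sq, inner_eq_integral]
  simp only [pow_two]

lemma sq_integral_mul_le {Ω : Type*} [MeasurableSpace Ω] {ν : Measure Ω} {f g : Ω → ℝ}
    (hf : MemLp f 2 ν) (hg : MemLp g 2 ν) :
    (∫ x, f x * g x ∂ν) ^ 2 ≤ (∫ x, f x ^ 2 ∂ν) * ∫ x, g x ^ 2 ∂ν := by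
  have key : ∀ {f g : Ω → ℝ} (hf : MemLp f 2 ν) (hg : MemLp g 2 ν),
      inner ℝ hf.toLp hg.toLp = ∫ x, f x * g x ∂ν := fun hf hg => by
    rw [L2.inner_def]
    refine integral_congr_ae ?_
    filter_upwards [hf.coeFn_toLp, hg.coeFn_toLp] with x h1 h2
    rw [h1, h2]
    simp [mul_comm]
  have := real_inner_mul_inner_self_le hf.toLp hg.toLp
  simp only [key] at this
  simpa only [pow_two] using this

/-- The constant function `1` as an element of `L²(-1, 1)`. -/
noncomputable def one : L2 := (memLp_const (1 : ℝ) : MemLp (fun _ : ℝ => (1 : ℝ)) 2 mu).toLp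

lemma coeFn_one : (one : ℝ → ℝ) =ᵐ[mu] fun _ => 1 := MemLp.coeFn_toLp _

/-- Exhaustion of `(-1, 1)` by countably many compact intervals; `1 / √a` is controlled only on
these. -/
lemma ae_mu_of_forall_Icc {P : ℝ → Prop}
    (h : ∀ s : ℝ, 0 < s → s < 1 → ∀ᵐ x, x ∈ Icc (-s) s → P x) : ∀ᵐ x ∂mu, P x := by
  rw [ae_restrict_iff' measurableSet_Ioo]
  have h1 : ∀ᵐ x, ∀ n : ℕ, x ∈ Icc (-(1 - 1 / ((n : ℝ) + 2))) (1 - 1 / ((n : ℝ) + 2)) → P x := by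
    rw [ae_all_iff]
    intro n
    have h2 : 1 / ((n : ℝ) + 2) < 1 := by
      rw [div_lt_one (by positivity)]
      linarith [(Nat.cast_nonneg n : (0 : ℝ) ≤ n)]
    exact h _ (by linarith) (by linarith [(by positivity : (0 : ℝ) < 1 / ((n : ℝ) + 2))])
  filter_upwards [h1] with x hx hx1
  obtain ⟨n, hn⟩ := exists_nat_one_div_lt (K := ℝ) (ε := 1 - |x|) (by
    have := abs_lt.mpr ⟨hx1.1, hx1.2⟩; linarith)
  have h3 : 1 / ((n : ℝ) + 2) ≤ 1 / ((n : ℝ) + 1) := by gcongr; norm_num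
  have h4 := le_abs_self x
  have h5 := neg_abs_le x
  exact hx n ⟨by linarith, by linarith⟩

lemma Icc_subset_Ioo_of_lt {s : ℝ} (hs : s < 1) : Icc (-s) s ⊆ Ioo (-1 : ℝ) 1 := fun x hx =>
  ⟨by linarith [hx.1], by linarith [hx.2]⟩

lemma integrable_coeFn (z : L2) : Integrable z mu := (Lp.memLp z).integrable (by norm_num)

lemma intervalIntegrable_coeFn (z : L2) : IntervalIntegrable z volume (-1) 1 := by
  rw [intervalIntegrable_iff_integrableOn_Ioo_of_le (by norm_num)]
  exact integrable_coeFn z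

lemma integral_mu_eq (f : ℝ → ℝ) : ∫ x, f x ∂mu = ∫ x in (-1 : ℝ)..1, f x := by
  rw [intervalIntegral.integral_of_le (by norm_num), integral_Ioc_eq_integral_Ioo]

namespace IsCoefficient

lemma continuousOn_Ioo (ha : IsCoefficient a) : ContinuousOn a (Ioo (-1) 1) :=
  ha.contDiffOn.continuousOn.mono Ioo_subset_Icc_self

lemma continuousOn_inv_sqrt (ha : IsCoefficient a) :
    ContinuousOn (fun x => 1 / √(a x)) (Ioo (-1) 1) :=
  continuousOn_const.div (ha.continuousOn_Ioo.sqrt) fun x hx =>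
    (Real.sqrt_pos.mpr (ha.pos x hx)).ne'

lemma aestronglyMeasurable_inv_sqrt (ha : IsCoefficient a) :
    AEStronglyMeasurable (fun x => 1 / √(a x)) mu :=
  ha.continuousOn_inv_sqrt.aestronglyMeasurable measurableSet_Ioo

lemma exists_bound (ha : IsCoefficient a) {c d : ℝ} (hc : -1 < c) (hd : d < 1) :
    ∃ b, ∀ x ∈ Icc c d, ‖1 / √(a x)‖ ≤ b :=
  isCompact_Icc.exists_bound_of_continuousOn
    (ha.continuousOn_inv_sqrt.mono fun _ hx => ⟨hc.trans_le hx.1, hx.2.trans_lt hd⟩)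

lemma integrableOn_div_sqrt (ha : IsCoefficient a) {c d : ℝ} (hc : -1 < c) (hd : d < 1)
    {p : ℝ → ℝ} (hp : Integrable p mu) : IntegrableOn (fun s => p s / √(a s)) (Icc c d) := by
  obtain ⟨b, hb⟩ := ha.exists_bound hc hd
  have hsub : Icc c d ⊆ Ioo (-1 : ℝ) 1 := fun x hx => ⟨hc.trans_le hx.1, hx.2.trans_lt hd⟩
  have h1 : IntegrableOn p (Icc c d) := IntegrableOn.mono_set hp hsub
  have h2 := Integrable.bdd_mul (c := b) h1 (ha.aestronglyMeasurable_inv_sqrt.mono_set hsub) (by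
    filter_upwards [ae_restrict_mem measurableSet_Icc] with x hx
    exact hb x hx)
  refine h2.congr (Eventually.of_forall fun x => ?_)
  simp only
  ring

lemma intervalIntegrable_div_sqrt (ha : IsCoefficient a) {x y : ℝ} (hx : x ∈ Ioo (-1 : ℝ) 1)
    (hy : y ∈ Ioo (-1 : ℝ) 1) {p : ℝ → ℝ} (hp : Integrable p mu) :
    IntervalIntegrable (fun s => p s / √(a s)) volume x y := by
  refine (ha.integrableOn_div_sqrt (c := min x y) (d := max x y) (lt_min hx.1 hy.1)
    (max_lt hx.2 hy.2) hp).intervalIntegrable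

end IsCoefficient

/-- The primitive `x ↦ ∫₀ˣ p / √a`. -/
noncomputable def primitive (a : ℝ → ℝ) (p : ℝ → ℝ) (x : ℝ) : ℝ := ∫ s in (0 : ℝ)..x, p s / √(a s)

lemma zero_mem_Ioo : (0 : ℝ) ∈ Ioo (-1 : ℝ) 1 := by norm_num

lemma uIcc_zero_subset {x : ℝ} (hx : x ∈ Ioo (-1 : ℝ) 1) : uIcc 0 x ⊆ Ioo (-1 : ℝ) 1 :=
  OrdConnected.uIcc_subset ordConnected_Ioo zero_mem_Ioo hx

lemma locAC_primitive (ha : IsCoefficient a) {p : ℝ → ℝ} (hp : Integrable p mu) :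
    LocAC (primitive a p) := by
  intro c d hc hcd hd
  have h1 : IntervalIntegrable (fun s => p s / √(a s)) volume (min c 0) (max d 0) :=
    ha.intervalIntegrable_div_sqrt ⟨lt_min hc (by norm_num), (min_le_right _ _).trans_lt one_pos⟩
      ⟨lt_of_lt_of_le (by norm_num) (le_max_right _ _), max_lt hd one_pos⟩ hp
  refine (h1.absolutelyContinuousOnInterval_intervalIntegral (c := 0) ?_).mono ?_
  · rw [uIcc_of_le ((min_le_right _ _).trans (le_max_right _ _))]
    exact ⟨min_le_right _ _, le_max_right _ _⟩
  · rw [uIcc_of_le hcd, uIcc_of_le ((min_le_right _ _).trans (le_max_right _ _))]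
    exact Icc_subset_Icc (min_le_left _ _) (le_max_left _ _)

lemma ae_hasDerivAt_primitive (ha : IsCoefficient a) {p : ℝ → ℝ} (hp : Integrable p mu) :
    ∀ᵐ x ∂mu, HasDerivAt (primitive a p) (p x / √(a x)) x := by
  refine ae_mu_of_forall_Icc fun s hs hs1 => ?_
  have h1 : IntervalIntegrable (fun s => p s / √(a s)) volume (-s) s :=
    ha.intervalIntegrable_div_sqrt ⟨by linarith, by linarith⟩ ⟨by linarith, by linarith⟩ hp
  filter_upwards [h1.ae_hasDerivAt_integral] with x hx hxs
  rw [uIcc_of_le (by linarith)] at hx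
  exact hx hxs 0 ⟨by linarith, hs.le⟩

lemma LocAC.continuousOn {f : ℝ → ℝ} (hf : LocAC f) : ContinuousOn f (Ioo (-1) 1) := by
  intro x hx
  have h1 := (hf ((x - 1) / 2) ((x + 1) / 2) (by linarith [hx.1]) (by linarith)
    (by linarith [hx.2])).continuousOn
  rw [uIcc_of_le (by linarith)] at h1
  exact (h1.continuousAt (Icc_mem_nhds (by linarith [hx.1])
    (by linarith [hx.2]))).continuousWithinAt

lemma LocAC.ae_differentiableAt {f : ℝ → ℝ} (hf : LocAC f) :
    ∀ᵐ x ∂mu, DifferentiableAt ℝ f x := by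
  refine ae_mu_of_forall_Icc fun s hs hs1 => ?_
  have h1 := (hf (-s) s (by linarith) (by linarith) hs1).ae_differentiableAt
  rwa [uIcc_of_le (by linarith)] at h1

/-- Cauchy–Schwarz for `p · a^(-1/2)`. The last factor is `|A(x)|`, so the hypothesis `A ∈ L¹` is
exactly what bounds the primitive in `L²`. -/
lemma sq_primitive_le (ha : IsCoefficient a) {p : ℝ → ℝ} (hp : MemLp p 2 mu) {x : ℝ}
    (hx : x ∈ Ioo (-1 : ℝ) 1) :
    primitive a p x ^ 2 ≤ (∫ s, p s ^ 2 ∂mu) * ‖∫ s in (0 : ℝ)..x, 1 / a s‖ := by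
  have hsub : uIoc 0 x ⊆ Ioo (-1 : ℝ) 1 := uIoc_subset_uIcc.trans (uIcc_zero_subset hx)
  have hp1 : MemLp p 2 (volume.restrict (uIoc 0 x)) :=
    hp.mono_measure (Measure.restrict_mono hsub le_rfl)
  obtain ⟨b, hb⟩ := ha.exists_bound (c := min 0 x) (d := max 0 x) (lt_min (by norm_num) hx.1)
    (max_lt one_pos hx.2)
  have : IsFiniteMeasure (volume.restrict (uIoc 0 x)) := ⟨by
    rw [Measure.restrict_apply_univ]
    exact (measure_mono uIoc_subset_uIcc).trans_lt isCompact_uIcc.measure_lt_top⟩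
  have hq1 : MemLp (fun s => 1 / √(a s)) 2 (volume.restrict (uIoc 0 x)) := by
    refine MemLp.of_bound (ha.aestronglyMeasurable_inv_sqrt.mono_set hsub) b ?_
    filter_upwards [ae_restrict_mem measurableSet_uIoc] with s hs
    exact hb s (uIoc_subset_uIcc hs)
  have h1 := sq_integral_mul_le hp1 hq1
  have h2 : primitive a p x ^ 2 = (∫ s in uIoc 0 x, p s * (1 / √(a s))) ^ 2 := by
    rw [← sq_abs (primitive a p x), primitive, ← Real.norm_eq_abs,
      intervalIntegral.norm_integral_eq_norm_integral_uIoc, Real.norm_eq_abs, sq_abs]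
    simp only [mul_one_div]
  have h3 : ∫ s in uIoc 0 x, (1 / √(a s)) ^ 2 = ‖∫ s in (0 : ℝ)..x, 1 / a s‖ := by
    rw [intervalIntegral.norm_integral_eq_norm_integral_uIoc, Real.norm_of_nonneg]
    · refine setIntegral_congr_fun measurableSet_uIoc fun s hs => ?_
      simp only [div_pow, one_pow, Real.sq_sqrt (ha.pos s (hsub hs)).le]
    · exact setIntegral_nonneg measurableSet_uIoc fun s hs =>
        (one_div_pos.mpr (ha.pos s (hsub hs))).le
  rw [h2, ← h3]
  refine h1.trans (mul_le_mul_of_nonneg_right ?_ (integral_nonneg fun s => sq_nonneg _))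
  exact setIntegral_mono_set hp.integrable_sq (Eventually.of_forall fun s => sq_nonneg _)
    (Eventually.of_forall fun _ h => hsub h)

lemma memLp_primitive (ha : IsCoefficient a) {p : ℝ → ℝ} (hp : MemLp p 2 mu) :
    MemLp (primitive a p) 2 mu := by
  have hm : AEStronglyMeasurable (primitive a p) mu :=
    (locAC_primitive ha (hp.integrable (by norm_num))).continuousOn.aestronglyMeasurable measurableSet_Ioo
  rw [memLp_two_iff_integrable_sq hm]
  refine Integrable.mono' (ha.integrable.norm.const_mul (∫ s, p s ^ 2 ∂mu)) (hm.pow 2) ?_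
  filter_upwards [ae_restrict_mem measurableSet_Ioo] with x hx
  rw [Real.norm_of_nonneg (sq_nonneg _)]
  exact sq_primitive_le ha hp hx

lemma integral_sq_primitive_le (ha : IsCoefficient a) {p : ℝ → ℝ} (hp : MemLp p 2 mu) :
    ∫ x, primitive a p x ^ 2 ∂mu ≤
      (∫ s, p s ^ 2 ∂mu) * ∫ x, ‖∫ s in (0 : ℝ)..x, 1 / a s‖ ∂mu := by
  rw [← integral_const_mul]
  refine integral_mono_ae (memLp_primitive ha hp).integrable_sq
    (ha.integrable.norm.const_mul _) ?_
  filter_upwards [ae_restrict_mem measurableSet_Ioo] with x hx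
  exact sq_primitive_le ha hp hx

lemma primitive_congr {p q : ℝ → ℝ} (hpq : p =ᵐ[mu] q) {x : ℝ} (hx : x ∈ Ioo (-1 : ℝ) 1) :
    primitive a p x = primitive a q x := by
  refine intervalIntegral.integral_congr_ae ?_
  have h1 := (ae_restrict_iff' measurableSet_Ioo).mp hpq
  filter_upwards [h1] with s hs hsx
  rw [hs (uIcc_zero_subset hx (uIoc_subset_uIcc hsx))]

/-- The bounded operator `p ↦ ∫₀ˣ p / √a` on `L²(-1, 1)`. -/
noncomputable def primitiveL (ha : IsCoefficient a) : L2 →L[ℝ] L2 :=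
  LinearMap.mkContinuous
    { toFun := fun p => (memLp_primitive ha (Lp.memLp p)).toLp
      map_add' := fun p q => by
        refine Lp.ext ?_
        filter_upwards [(memLp_primitive ha (Lp.memLp (p + q))).coeFn_toLp,
          Lp.coeFn_add (memLp_primitive ha (Lp.memLp p)).toLp
            (memLp_primitive ha (Lp.memLp q)).toLp,
          (memLp_primitive ha (Lp.memLp p)).coeFn_toLp,
          (memLp_primitive ha (Lp.memLp q)).coeFn_toLp,
          ae_restrict_mem measurableSet_Ioo] with x h1 h2 h3 h4 hx
        rw [h1, h2, Pi.add_apply, h3, h4, primitive_congr (Lp.coeFn_add p q) hx, primitive,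
          primitive, primitive, ← intervalIntegral.integral_add
            (ha.intervalIntegrable_div_sqrt zero_mem_Ioo hx (integrable_coeFn p))
            (ha.intervalIntegrable_div_sqrt zero_mem_Ioo hx (integrable_coeFn q))]
        simp only [Pi.add_apply, add_div]
      map_smul' := fun c p => by
        refine Lp.ext ?_
        filter_upwards [(memLp_primitive ha (Lp.memLp (c • p))).coeFn_toLp,
          Lp.coeFn_smul c (memLp_primitive ha (Lp.memLp p)).toLp,
          (memLp_primitive ha (Lp.memLp p)).coeFn_toLp,
          ae_restrict_mem measurableSet_Ioo] with x h1 h2 h3 hx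
        rw [h1, RingHom.id_apply, h2, Pi.smul_apply, h3, primitive_congr (Lp.coeFn_smul c p) hx,
          primitive, primitive, smul_eq_mul, ← intervalIntegral.integral_const_mul]
        simp only [Pi.smul_apply, smul_eq_mul, mul_div_assoc] }
    (√(∫ x, ‖∫ s in (0 : ℝ)..x, 1 / a s‖ ∂mu)) (fun p => by
      have h0 : 0 ≤ ∫ x, ‖∫ s in (0 : ℝ)..x, 1 / a s‖ ∂mu := integral_nonneg fun _ => norm_nonneg _
      refine (pow_le_pow_iff_left₀ (norm_nonneg _) (by positivity) two_ne_zero).mp ?_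
      rw [mul_pow, Real.sq_sqrt h0, norm_sq_eq_integral, norm_sq_eq_integral, mul_comm]
      refine le_trans (le_of_eq (integral_congr_ae ?_))
        (integral_sq_primitive_le ha (Lp.memLp p))
      filter_upwards [(memLp_primitive ha (Lp.memLp p)).coeFn_toLp] with x hx
      exact congrArg (· ^ 2) hx)

lemma coeFn_primitiveL (ha : IsCoefficient a) (p : L2) :
    primitiveL ha p =ᵐ[mu] primitive a p :=
  (memLp_primitive ha (Lp.memLp p)).coeFn_toLp

/-- `H¹ₐ(-1, 1)` consists of the functions `c + ∫₀ˣ p / √a` with `p ∈ L²(-1, 1)`. -/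
lemma hasWeightedDeriv_iff (ha : IsCoefficient a) (u p : L2) :
    HasWeightedDeriv a u p ↔ ∃ c : ℝ, u = c • one + primitiveL ha p := by
  constructor
  · rintro ⟨f, hf, huf, hpf⟩
    refine ⟨f 0, Lp.ext ?_⟩
    filter_upwards [huf, Lp.coeFn_add (f 0 • one) (primitiveL ha p), Lp.coeFn_smul (f 0) one,
      coeFn_one, coeFn_primitiveL ha p, ae_restrict_mem measurableSet_Ioo] with x h1 h2 h3 h4 h5 hx
    rw [h1, h2, Pi.add_apply, h3, Pi.smul_apply, h4, h5]
    have h6 : primitive a p x = ∫ s in (0 : ℝ)..x, deriv f s := by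
      refine intervalIntegral.integral_congr_ae ?_
      filter_upwards [(ae_restrict_iff' measurableSet_Ioo).mp hpf] with s hs hsx
      have hs1 := uIcc_zero_subset hx (uIoc_subset_uIcc hsx)
      rw [hs hs1, mul_div_assoc, mul_div_cancel₀]
      exact (Real.sqrt_pos.mpr (ha.pos s hs1)).ne'
    have h7 : AbsolutelyContinuousOnInterval f 0 x :=
      (hf (min 0 x) (max 0 x) (lt_min (by norm_num) hx.1) min_le_max (max_lt one_pos hx.2)).mono
        (by rw [uIcc_of_le min_le_max]; rfl)
    rw [h6, h7.integral_deriv_eq_sub]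
    simp
  · rintro ⟨c, rfl⟩
    refine ⟨fun x => c + primitive a p x, ?_, ?_, ?_⟩
    · intro y z hy hyz hz
      exact (LipschitzOnWith.absolutelyContinuousOnInterval (K := 0)
        (LipschitzWith.const c).lipschitzOnWith).add
          (locAC_primitive ha (integrable_coeFn p) y z hy hyz hz)
    · filter_upwards [Lp.coeFn_add (c • one) (primitiveL ha p), Lp.coeFn_smul c one,
        coeFn_one, coeFn_primitiveL ha p] with x h2 h3 h4 h5
      rw [h2, Pi.add_apply, h3, Pi.smul_apply, h4, h5]
      simp
    · filter_upwards [ae_hasDerivAt_primitive ha (integrable_coeFn p),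
        ae_restrict_mem measurableSet_Ioo] with x h1 hx
      rw [(h1.const_add c).deriv, mul_div_cancel₀]
      exact (Real.sqrt_pos.mpr (ha.pos x hx)).ne'

end DegPar

/-! ### The Neumann operator through the adjoint of the primitive. -/

namespace DegPar

open Filter Topology

variable {a : ℝ → ℝ}

/-- The antiderivative of `z` that vanishes at `-1`. -/
noncomputable def flux (z : ℝ → ℝ) (x : ℝ) : ℝ := ∫ s in (-1 : ℝ)..x, z s

lemma absolutelyContinuous_flux (z : L2) : AbsolutelyContinuousOnInterval (flux z) (-1) 1 :=
  (intervalIntegrable_coeFn z).absolutelyContinuousOnInterval_intervalIntegral (by simp)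

lemma flux_neg_one (z : ℝ → ℝ) : flux z (-1) = 0 := by simp [flux]

lemma inner_one (z : L2) : inner ℝ z one = ∫ x, z x ∂mu := by
  rw [inner_eq_integral]
  refine integral_congr_ae ?_
  filter_upwards [coeFn_one] with x hx
  rw [hx, mul_one]

lemma flux_one (z : L2) : flux z 1 = inner ℝ z one := by
  rw [inner_one, integral_mu_eq, flux]

lemma ae_hasDerivAt_flux (z : L2) : ∀ᵐ x ∂mu, HasDerivAt (flux z) (z x) x := by
  rw [ae_restrict_iff' measurableSet_Ioo]
  filter_upwards [(intervalIntegrable_coeFn z).ae_hasDerivAt_integral] with x hx hx1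
  rw [uIcc_of_le (by norm_num)] at hx
  exact hx (Ioo_subset_Icc_self hx1) (-1) ⟨le_rfl, by norm_num⟩

/-- Integration by parts against the primitive of a function with compact support. -/
lemma inner_primitiveL_of_support (ha : IsCoefficient a) {z : L2} (hz : inner ℝ z one = 0) (r : L2)
    {s : ℝ} (hs1 : s < 1) (hr : ∀ᵐ x ∂mu, x ∉ Icc (-s) s → r x = 0) :
    inner ℝ z (primitiveL ha r) = -∫ x, flux z x * (r x / √(a x)) ∂mu := by
  have hint : Integrable (fun x => r x / √(a x)) mu := by
    have h1 : IntegrableOn (fun x => r x / √(a x)) (Icc (-s) s) :=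
      ha.integrableOn_div_sqrt (by linarith) hs1 (integrable_coeFn r)
    have h2 := (integrable_indicator_iff measurableSet_Icc).mpr h1
    refine (h2.mono_measure (Measure.restrict_le_self (s := Ioo (-1) 1))).congr ?_
    filter_upwards [hr] with x hx
    by_cases hxs : x ∈ Icc (-s) s
    · rw [indicator_of_mem hxs]
    · rw [indicator_of_notMem hxs, hx hxs, zero_div]
  have hint' : IntervalIntegrable (fun x => r x / √(a x)) volume (-1) 1 := by
    rw [intervalIntegrable_iff_integrableOn_Ioo_of_le (by norm_num)]
    exact hint
  have hac : AbsolutelyContinuousOnInterval (primitive a r) (-1) 1 :=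
    hint'.absolutelyContinuousOnInterval_intervalIntegral (by
      rw [uIcc_of_le (by norm_num)]; norm_num)
  -- The support of `r` makes its primitive absolutely continuous up to `±1`; the boundary terms
  -- vanish because the flux is zero at `-1` by definition and at `1` by zero mean.
  have h3 := (absolutelyContinuous_flux z).integral_mul_deriv_eq_deriv_mul hac
  rw [flux_one, hz, flux_neg_one, zero_mul, zero_mul, sub_zero, zero_sub, ← integral_mu_eq,
    ← integral_mu_eq] at h3
  have h4 : ∫ x, flux z x * deriv (primitive a r) x ∂mu = ∫ x, flux z x * (r x / √(a x)) ∂mu := by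
    refine integral_congr_ae ?_
    filter_upwards [ae_hasDerivAt_primitive ha (integrable_coeFn r)] with x hx
    rw [hx.deriv]
  have h5 : ∫ x, deriv (flux z) x * primitive a r x ∂mu = inner ℝ z (primitiveL ha r) := by
    rw [inner_eq_integral]
    refine integral_congr_ae ?_
    filter_upwards [ae_hasDerivAt_flux z, coeFn_primitiveL ha r] with x hx hx1
    rw [hx.deriv, hx1]
  rw [h4, h5] at h3
  rw [h3, neg_neg]

/-- The adjoint of `primitiveL` on functions with zero mean. -/
lemma coeFn_adjoint_primitiveL (ha : IsCoefficient a) {z : L2} (hz : inner ℝ z one = 0) :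
    ContinuousLinearMap.adjoint (primitiveL ha) z =ᵐ[mu] fun x => -(flux z x / √(a x)) := by
  set k := ContinuousLinearMap.adjoint (primitiveL ha) z with hk
  have hfc : ContinuousOn (flux z) (Icc (-1) 1) := by
    have := (absolutelyContinuous_flux z).continuousOn
    rwa [uIcc_of_le (by norm_num)] at this
  set g : ℝ → ℝ := fun x => k x + flux z x * (1 / √(a x)) with hg
  suffices h : ∀ᵐ x ∂mu, g x = 0 by
    filter_upwards [h] with x hx
    rw [hg] at hx
    simp only [mul_one_div] at hx
    linarith
  refine ae_mu_of_forall_Icc fun s hs hs1 => ?_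
  have hsub := Icc_subset_Ioo_of_lt hs1
  have hbd : ∃ C, ∀ x ∈ Icc (-s) s, ‖flux z x * (1 / √(a x))‖ ≤ C :=
    isCompact_Icc.exists_bound_of_continuousOn
      ((hfc.mono (hsub.trans Ioo_subset_Icc_self)).mul (ha.continuousOn_inv_sqrt.mono hsub))
  obtain ⟨C, hC⟩ := hbd
  have hfl : MemLp ((Icc (-s) s).indicator fun x => flux z x * (1 / √(a x))) 2 mu := by
    refine MemLp.of_bound ((((hfc.mono Ioo_subset_Icc_self).aestronglyMeasurable
      measurableSet_Ioo).mul ha.aestronglyMeasurable_inv_sqrt).indicator measurableSet_Icc)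
      (max C 0) (Eventually.of_forall fun x => ?_)
    by_cases hx : x ∈ Icc (-s) s
    · rw [indicator_of_mem hx]; exact (hC x hx).trans (le_max_left _ _)
    · rw [indicator_of_notMem hx, norm_zero]; exact le_max_right _ _
  have hr : MemLp ((Icc (-s) s).indicator g) 2 mu := by
    have := ((Lp.memLp k).indicator (measurableSet_Icc (a := -s) (b := s))).add hfl
    rw [← indicator_add'] at this
    exact this
  set R : L2 := hr.toLp with hR
  have hRc : R =ᵐ[mu] (Icc (-s) s).indicator g := hr.coeFn_toLp
  -- The defect `g`, cut off to `[-s, s]`, serves as its own test function: the adjoint relation and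
  -- the integration by parts cancel.
  have h0 : ∫ x, (Icc (-s) s).indicator g x ^ 2 ∂mu = 0 := by
    have h1 : inner ℝ k R = inner ℝ z (primitiveL ha R) :=
      ContinuousLinearMap.adjoint_inner_left _ _ _
    rw [inner_primitiveL_of_support ha hz _ hs1 (by
      filter_upwards [hRc] with x hx hxs
      rw [hx, indicator_of_notMem hxs]), inner_eq_integral] at h1
    have h2 : ∀ᵐ x ∂mu, (Icc (-s) s).indicator g x ^ 2 =
        k x * R x + flux z x * (R x / √(a x)) := by
      filter_upwards [hRc] with x hx
      rw [hx]
      by_cases hxs : x ∈ Icc (-s) s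
      · rw [indicator_of_mem hxs, hg]; ring
      · rw [indicator_of_notMem hxs]; ring
    have h3 : Integrable (fun x => k x * R x) mu := (Lp.memLp k).integrable_mul (Lp.memLp _)
    have h4 : Integrable (fun x => flux z x * (R x / √(a x))) mu := by
      have : Integrable _ mu := hfl.integrable_mul hr
      refine this.congr ?_
      filter_upwards [hRc] with x hx
      rw [hx, Pi.mul_apply]
      by_cases hxs : x ∈ Icc (-s) s
      · rw [indicator_of_mem hxs, indicator_of_mem hxs]; ring
      · rw [indicator_of_notMem hxs, indicator_of_notMem hxs]; ring
    rw [integral_congr_ae h2, integral_add h3 h4, h1, neg_add_cancel]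
  have h5 := (integral_eq_zero_iff_of_nonneg (fun x => sq_nonneg _) hr.integrable_sq).mp h0
  filter_upwards [(ae_restrict_iff' measurableSet_Ioo).mp h5] with x hx hxs
  have := hx (hsub hxs)
  simpa [indicator_of_mem hxs] using this

/-- The degenerate operator with Neumann conditions in terms of `primitiveL`. -/
lemma isDegOp_iff (ha : IsCoefficient a) (w z : L2) :
    IsDegOp a w z ↔ inner ℝ z one = 0 ∧
      HasWeightedDeriv a w (-ContinuousLinearMap.adjoint (primitiveL ha) z) := by
  constructor
  · rintro ⟨f, q, hf, hwf, -, hq, hqf, hq0, hq1, hzq⟩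
    -- Both functions vanish at `-1` and have the same derivative; `q 1 = 0` then says that `z` has
    -- zero mean.
    have hfl : ∀ x ∈ Icc (-1 : ℝ) 1, flux z x = q x := by
      intro x hx
      have h1 := (hq.mono (c := -1) (d := x) (by
        rw [uIcc_of_le hx.1, uIcc_of_le (by norm_num)]
        exact Icc_subset_Icc_right hx.2)).integral_deriv_eq_sub
      rw [hq0, sub_zero] at h1
      rw [← h1, flux]
      refine intervalIntegral.integral_congr_ae ?_
      have h3 : ∀ᵐ s : ℝ, s ≠ 1 := by simp [ae_iff, measure_singleton]
      filter_upwards [(ae_restrict_iff' measurableSet_Ioo).mp hzq, h3] with s hs hs1 hsx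
      rw [uIoc_of_le hx.1] at hsx
      exact hs ⟨hsx.1, lt_of_le_of_ne (hsx.2.trans hx.2) hs1⟩
    have hz : inner ℝ z one = 0 := by
      rw [← flux_one, hfl 1 ⟨by norm_num, le_rfl⟩, hq1]
    refine ⟨hz, f, hf, hwf, ?_⟩
    filter_upwards [coeFn_adjoint_primitiveL ha hz, hqf, ae_restrict_mem measurableSet_Ioo,
      Lp.coeFn_neg (ContinuousLinearMap.adjoint (primitiveL ha) z)] with x h1 h2 hx h3
    have hpos := Real.sqrt_pos.mpr (ha.pos x hx)
    rw [h3, Pi.neg_apply, h1, neg_neg, hfl x (Ioo_subset_Icc_self hx), h2,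
      div_eq_iff hpos.ne', mul_right_comm, Real.mul_self_sqrt (ha.pos x hx).le]
  · rintro ⟨hz, f, hf, hwf, hp⟩
    refine ⟨f, flux z, hf, hwf, (Lp.memLp _).ae_eq hp, absolutelyContinuous_flux z, ?_,
      flux_neg_one z, by rw [flux_one, hz], ?_⟩
    · filter_upwards [coeFn_adjoint_primitiveL ha hz, hp, ae_restrict_mem measurableSet_Ioo,
        Lp.coeFn_neg (ContinuousLinearMap.adjoint (primitiveL ha) z)] with x h1 h2 hx h3
      have hpos := Real.sqrt_pos.mpr (ha.pos x hx)
      rw [h3, Pi.neg_apply, h1, neg_neg, div_eq_iff hpos.ne', mul_right_comm,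
        Real.mul_self_sqrt (ha.pos x hx).le] at h2
      exact h2
    · filter_upwards [ae_hasDerivAt_flux z] with x hx
      exact hx.deriv.symm

/-- Weak form of the operator: zero mean removes the constant part of `v`, and the adjoint handles
the rest. -/
lemma HasWeightedDeriv.inner_eq (ha : IsCoefficient a) {z v r : L2} (hz : inner ℝ z one = 0)
    (hv : HasWeightedDeriv a v r) :
    inner ℝ z v = inner ℝ (ContinuousLinearMap.adjoint (primitiveL ha) z) r := by
  obtain ⟨c, rfl⟩ := (hasWeightedDeriv_iff ha v r).mp hv
  rw [inner_add_right, inner_smul_right, hz, mul_zero, zero_add,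
    ContinuousLinearMap.adjoint_inner_left]

lemma HasWeightedDeriv.sub (ha : IsCoefficient a) {u v p r : L2} (hu : HasWeightedDeriv a u p)
    (hv : HasWeightedDeriv a v r) : HasWeightedDeriv a (u - v) (p - r) := by
  obtain ⟨c, rfl⟩ := (hasWeightedDeriv_iff ha u p).mp hu
  obtain ⟨d, rfl⟩ := (hasWeightedDeriv_iff ha v r).mp hv
  refine (hasWeightedDeriv_iff ha _ _).mpr ⟨c - d, ?_⟩
  rw [map_sub, sub_smul]
  abel

lemma HasWeightedDeriv.smul (ha : IsCoefficient a) {u p : L2} (hu : HasWeightedDeriv a u p)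
    (c : ℝ) : HasWeightedDeriv a (c • u) (c • p) := by
  obtain ⟨d, rfl⟩ := (hasWeightedDeriv_iff ha u p).mp hu
  refine (hasWeightedDeriv_iff ha _ _).mpr ⟨c * d, ?_⟩
  rw [map_smul, smul_add, smul_smul]

/-- The relation is the preimage of the line of constants under the continuous map `(u, p) ↦ u - B
p`, where `B` is `primitiveL ha`. -/
lemma isClosed_hasWeightedDeriv (ha : IsCoefficient a) :
    IsClosed {x : L2 × L2 | HasWeightedDeriv a x.1 x.2} := by
  have h1 : {x : L2 × L2 | HasWeightedDeriv a x.1 x.2} =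
      (fun x : L2 × L2 => x.1 - primitiveL ha x.2) ⁻¹' (Submodule.span ℝ {one} : Set L2) := by
    ext x
    simp only [mem_ofPred_eq, mem_preimage, SetLike.mem_coe, Submodule.mem_span_singleton,
      hasWeightedDeriv_iff ha, sub_eq_iff_eq_add, eq_comm (a := _ • one)]
  rw [h1]
  exact (Submodule.closed_of_finiteDimensional _).preimage (by fun_prop)

/-- Passing to the absolute value does not increase the Dirichlet energy. -/
lemma HasWeightedDeriv.abs (ha : IsCoefficient a) {u p : L2} (hu : HasWeightedDeriv a u p) :
    ∃ r, HasWeightedDeriv a |u| r ∧ ‖r‖ ≤ ‖p‖ := by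
  obtain ⟨f, hf, huf, hpf⟩ := hu
  have hfa : LocAC fun x => |f x| := by
    intro c d hc hcd hd
    have h1 := hf c d hc hcd hd
    rw [absolutelyContinuousOnInterval_iff] at h1 ⊢
    intro ε hε
    obtain ⟨δ, hδ, h2⟩ := h1 ε hε
    refine ⟨δ, hδ, fun E hE hE1 => (Finset.sum_le_sum fun i _ => ?_).trans_lt (h2 E hE hE1)⟩
    rw [Real.dist_eq, Real.dist_eq]
    exact abs_abs_sub_abs_le _ _
  have hd : ∀ᵐ x ∂mu, DifferentiableAt ℝ f x ∧ DifferentiableAt ℝ (fun x => |f x|) x := by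
    filter_upwards [hf.ae_differentiableAt, hfa.ae_differentiableAt] with x hx1 hx2
    exact ⟨hx1, hx2⟩
  -- Difference quotients of `|f|` are dominated in absolute value by those of `f`.
  have hle : ∀ᵐ x ∂mu, |deriv (fun x => |f x|) x| ≤ |deriv f x| := by
    filter_upwards [hd] with x hx
    have h1 := (hx.1.hasDerivAt.tendsto_slope).abs
    have h2 := (hx.2.hasDerivAt.tendsto_slope).abs
    refine le_of_tendsto_of_tendsto' h2 h1 fun y => ?_
    rw [slope_def_field, slope_def_field, abs_div, abs_div]
    exact div_le_div_of_nonneg_right (abs_abs_sub_abs_le _ _) (abs_nonneg _)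
  have hle2 : ∀ᵐ x ∂mu, ‖√(a x) * deriv (fun x => |f x|) x‖ ≤ ‖p x‖ := by
    filter_upwards [hle, hpf] with x hx hx1
    rw [hx1, norm_mul, norm_mul]
    exact mul_le_mul_of_nonneg_left hx (norm_nonneg _)
  have hm : AEStronglyMeasurable (fun x => √(a x) * deriv (fun x => |f x|) x) mu :=
    (ha.continuousOn_Ioo.sqrt.aestronglyMeasurable measurableSet_Ioo).mul
      (measurable_deriv _).aestronglyMeasurable
  have hmem : MemLp (fun x => √(a x) * deriv (fun x => |f x|) x) 2 mu :=
    (Lp.memLp p).mono hm hle2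
  refine ⟨hmem.toLp, ⟨_, hfa, ?_, hmem.coeFn_toLp⟩, ?_⟩
  · filter_upwards [huf, Lp.coeFn_abs u] with x h1 h2
    rw [h2, h1]
  · refine Lp.norm_le_norm_of_ae_le ?_
    filter_upwards [hle2, hmem.coeFn_toLp] with x h1 h2
    rwa [h2]

end DegPar

/-! ### Bounded perturbations of the operator: range condition and positivity. -/

namespace DegPar

open Filter Topology

variable {a : ℝ → ℝ}

/-- The graph of `A₀ + M` for a bounded operator `M`. -/
noncomputable def degGraph (ha : IsCoefficient a) (M : L2 →L[ℝ] L2) : Submodule ℝ (L2 × L2) where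
  carrier := {x | IsDegOp a x.1 (x.2 - M x.1)}
  zero_mem' := by
    simp only [mem_ofPred_eq, Prod.fst_zero, Prod.snd_zero, map_zero, sub_zero]
    refine (isDegOp_iff ha _ _).mpr ⟨inner_zero_left _, (hasWeightedDeriv_iff ha _ _).mpr ⟨0, ?_⟩⟩
    simp
  add_mem' := by
    intro x y hx hy
    obtain ⟨h1, h2⟩ := (isDegOp_iff ha _ _).mp hx
    obtain ⟨h3, h4⟩ := (isDegOp_iff ha _ _).mp hy
    have h5 := h2.sub ha (h4.smul ha (-1))
    have e : (x + y).2 - M (x + y).1 = (x.2 - M x.1) + (y.2 - M y.1) := by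
      simp only [Prod.snd_add, Prod.fst_add, map_add]; abel
    change IsDegOp a (x + y).1 ((x + y).2 - M (x + y).1)
    rw [e]
    refine (isDegOp_iff ha _ _).mpr ⟨by rw [inner_add_left, h1, h3, add_zero], ?_⟩
    convert h5 using 1
    · rw [Prod.fst_add]; module
    · rw [map_add]; module
  smul_mem' := by
    intro c x hx
    obtain ⟨h1, h2⟩ := (isDegOp_iff ha _ _).mp hx
    have e : (c • x).2 - M (c • x).1 = c • (x.2 - M x.1) := by
      simp only [Prod.smul_snd, Prod.smul_fst, map_smul, smul_sub]
    change IsDegOp a (c • x).1 ((c • x).2 - M (c • x).1)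
    rw [e]
    refine (isDegOp_iff ha _ _).mpr ⟨by rw [inner_smul_left, h1, mul_zero], ?_⟩
    have := h2.smul ha c
    rwa [smul_neg, ← map_smul] at this

lemma mem_degGraph (ha : IsCoefficient a) (M : L2 →L[ℝ] L2) (x : L2 × L2) :
    x ∈ degGraph ha M ↔ IsDegOp a x.1 (x.2 - M x.1) := Iff.rfl

/-- Single-valuedness: the continuous representatives `f` and then `q` vanish identically on `(-1,
1)`, hence so does `z = q'`. -/
lemma IsDegOp.eq_zero {z : L2} (hz : IsDegOp a 0 z) : z = 0 := by
  obtain ⟨f, q, hf, hwf, -, hq, hqf, -, -, hzq⟩ := hz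
  have hqc : ContinuousOn q (Ioo (-1) 1) := by
    have := hq.continuousOn
    rw [uIcc_of_le (by norm_num)] at this
    exact this.mono Ioo_subset_Icc_self
  have hf0 : EqOn f 0 (Ioo (-1) 1) := by
    refine Measure.eqOn_open_of_ae_eq (μ := volume) ?_ isOpen_Ioo hf.continuousOn continuousOn_const
    exact hwf.symm.trans (Lp.coeFn_zero _ _ _)
  have hd : ∀ {g : ℝ → ℝ}, EqOn g 0 (Ioo (-1) 1) → ∀ x ∈ Ioo (-1 : ℝ) 1, deriv g x = 0 := by
    intro g hg x hx
    have : g =ᶠ[𝓝 x] fun _ => 0 := hg.eventuallyEq_of_mem (Ioo_mem_nhds hx.1 hx.2)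
    rw [this.deriv_eq, deriv_const]
  have hq0 : EqOn q 0 (Ioo (-1) 1) := by
    refine Measure.eqOn_open_of_ae_eq (μ := volume) ?_ isOpen_Ioo hqc continuousOn_const
    filter_upwards [hqf, ae_restrict_mem measurableSet_Ioo] with x hx hx1
    rw [hx, hd hf0 x hx1, mul_zero]
    rfl
  refine Lp.ext ?_
  filter_upwards [hzq, ae_restrict_mem measurableSet_Ioo, Lp.coeFn_zero ℝ 2 mu] with x hx hx1 h0
  rw [hx, hd hq0 x hx1, h0]
  rfl

/-- The range condition for the unperturbed operator. -/
lemma exists_isDegOp_sub_smul_eq (ha : IsCoefficient a) {h : ℝ} (hh : 0 < h) (f : L2) :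
    ∃ u z, IsDegOp a u z ∧ u - h • z = f := by
  -- With `P` the projection onto zero mean, `h + P B B' P` is coercive, hence invertible. Solving
  -- for `-P f` gives `z` of zero mean such that `f + h z + B B' z` is constant, which is the
  -- operator equation.
  set U : Submodule ℝ L2 := Submodule.span ℝ {one} with hU
  set P : L2 →L[ℝ] L2 := Uᗮ.starProjection with hP
  set B := primitiveL ha with hB
  set B' := ContinuousLinearMap.adjoint B with hB'
  set K : L2 →L[ℝ] L2 := h • (1 : L2 →L[ℝ] L2) + P ∘L B ∘L B' ∘L P with hK
  have hKapp : ∀ x, K x = h • x + P (B (B' (P x))) := fun x => rfl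
  have hunit : IsUnit K := by
    refine ContinuousLinearMap.isUnit_of_forall_le_norm_inner_map K (c := ⟨h, hh.le⟩) hh fun x => ?_
    have h1 : inner ℝ (K x) x = h * ‖x‖ ^ 2 + ‖B' (P x)‖ ^ 2 := by
      rw [hKapp, inner_add_left, inner_smul_left, real_inner_self_eq_norm_sq, hP,
        Submodule.inner_starProjection_left_eq_right, ← hP, ← real_inner_self_eq_norm_sq (B' (P x)),
        hB', ContinuousLinearMap.adjoint_inner_right]
      rfl
    rw [h1, Real.norm_of_nonneg (by positivity)]
    change ‖x‖ ^ 2 * h ≤ _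
    linarith [sq_nonneg ‖B' (P x)‖]
  obtain ⟨z, hz⟩ := ((ContinuousLinearMap.isUnit_iff_bijective).mp hunit).2 (-P f)
  rw [hKapp] at hz
  have hzU : z ∈ Uᗮ := by
    have h1 : z = h⁻¹ • (-P f - P (B (B' (P z)))) := by
      rw [← hz, add_sub_cancel_right, smul_smul, inv_mul_cancel₀ hh.ne', one_smul]
    rw [h1]
    exact Uᗮ.smul_mem _ (Uᗮ.sub_mem (Uᗮ.neg_mem (Submodule.starProjection_apply_mem _ _))
      (Submodule.starProjection_apply_mem _ _))
  have hPz : P z = z := Submodule.starProjection_eq_self_iff.mpr hzU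
  refine ⟨f + h • z, z, (isDegOp_iff ha _ _).mpr ⟨?_, (hasWeightedDeriv_iff ha _ _).mpr ?_⟩,
    add_sub_cancel_right _ _⟩
  · exact (Submodule.mem_orthogonal' _ _).mp hzU _ (Submodule.mem_span_singleton_self _)
  · have h2 : P (f + h • z + B (B' z)) = 0 := by
      rw [map_add, map_add, map_smul, hPz]
      rw [hPz] at hz
      rw [add_assoc, hz, add_neg_cancel]
    rw [hP, Submodule.starProjection_apply_eq_zero_iff, Submodule.orthogonal_orthogonal,
      hU, Submodule.mem_span_singleton] at h2
    obtain ⟨c, hc⟩ := h2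
    refine ⟨c, ?_⟩
    rw [hc, map_neg]
    abel

lemma inner_of_mem_degGraph (ha : IsCoefficient a) {M : L2 →L[ℝ] L2} {x : L2 × L2}
    (hx : x ∈ degGraph ha M) {v r : L2} (hv : HasWeightedDeriv a v r) :
    inner ℝ (x.2 - M x.1) v =
      -inner ℝ (-ContinuousLinearMap.adjoint (primitiveL ha) (x.2 - M x.1)) r := by
  rw [inner_neg_left, neg_neg]
  exact hv.inner_eq ha ((isDegOp_iff ha _ _).mp hx).1

lemma hasWeightedDeriv_of_mem_degGraph (ha : IsCoefficient a) {M : L2 →L[ℝ] L2} {x : L2 × L2}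
    (hx : x ∈ degGraph ha M) :
    HasWeightedDeriv a x.1 (-ContinuousLinearMap.adjoint (primitiveL ha) (x.2 - M x.1)) :=
  ((isDegOp_iff ha _ _).mp hx).2

/-- The energy identity for `A₀ + M`. -/
lemma norm_sq_of_mem_degGraph (ha : IsCoefficient a) {M : L2 →L[ℝ] L2} {x : L2 × L2}
    (hx : x ∈ degGraph ha M) :
    ‖-ContinuousLinearMap.adjoint (primitiveL ha) (x.2 - M x.1)‖ ^ 2 =
      -inner ℝ x.1 x.2 + inner ℝ (M x.1) x.1 := by
  have h1 := inner_of_mem_degGraph ha hx (hasWeightedDeriv_of_mem_degGraph ha hx)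
  rw [real_inner_self_eq_norm_sq, inner_sub_left, real_inner_comm] at h1
  linarith

lemma degGraph_symm (ha : IsCoefficient a) {M : L2 →L[ℝ] L2}
    (hM : ∀ x y, inner ℝ (M x) y = inner ℝ x (M y)) {x y : L2 × L2} (hx : x ∈ degGraph ha M)
    (hy : y ∈ degGraph ha M) : inner ℝ x.1 y.2 = inner ℝ x.2 y.1 := by
  have h1 := inner_of_mem_degGraph ha hx (hasWeightedDeriv_of_mem_degGraph ha hy)
  have h2 := inner_of_mem_degGraph ha hy (hasWeightedDeriv_of_mem_degGraph ha hx)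
  rw [real_inner_comm] at h2
  rw [real_inner_comm _ (-ContinuousLinearMap.adjoint (primitiveL ha) (y.2 - M y.1))] at h2
  rw [inner_sub_left] at h1
  rw [inner_sub_right] at h2
  have h3 := hM x.1 y.1
  linarith

lemma degGraph_diss (ha : IsCoefficient a) {M : L2 →L[ℝ] L2}
    (hM : ∀ u p, HasWeightedDeriv a u p → inner ℝ (M u) u ≤ ‖p‖ ^ 2) {x : L2 × L2}
    (hx : x ∈ degGraph ha M) : inner ℝ x.1 x.2 ≤ 0 := by
  have h1 := hM _ _ (hasWeightedDeriv_of_mem_degGraph ha hx)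
  have h2 := norm_sq_of_mem_degGraph ha hx
  linarith

lemma degGraph_single (ha : IsCoefficient a) {M : L2 →L[ℝ] L2} {z : L2}
    (hz : ((0 : L2), z) ∈ degGraph ha M) : z = 0 := by
  rw [mem_degGraph, map_zero, sub_zero] at hz
  exact hz.eq_zero

lemma isDissipativeGraph_degGraph_zero (ha : IsCoefficient a) :
    IsDissipativeGraph (degGraph ha 0) where
  symm x hx y hy := degGraph_symm ha (by simp) hx hy
  diss x hx := degGraph_diss ha (fun u p _ => by simp) hx
  single z hz := degGraph_single ha hz
  range := ⟨1, one_pos, fun h hh _ f => by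
    obtain ⟨u, z, huz, hf⟩ := exists_isDegOp_sub_smul_eq ha hh f
    exact ⟨(u, z), by simpa [mem_degGraph] using huz, hf⟩⟩

/-- Bounded symmetric perturbations of the degenerate operator that keep it dissipative. -/
theorem isDissipativeGraph_degGraph (ha : IsCoefficient a) {M : L2 →L[ℝ] L2}
    (hMs : ∀ x y, inner ℝ (M x) y = inner ℝ x (M y))
    (hM : ∀ u p, HasWeightedDeriv a u p → inner ℝ (M u) u ≤ ‖p‖ ^ 2) :
    IsDissipativeGraph (degGraph ha M) where
  symm x hx y hy := degGraph_symm ha hMs hx hy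
  diss x hx := degGraph_diss ha hM hx
  single z hz := degGraph_single ha hz
  range := by
    have hG := isDissipativeGraph_degGraph_zero ha
    obtain ⟨h₀, hh₀, hr⟩ := hG.exists_resolvent
    -- The second bound gives `‖h J M‖ < 1`, so a Neumann series solves `u = J (f + h M u)`.
    refine ⟨min h₀ (1 / (‖M‖ + 1)), by positivity, fun h hh hlt f => ?_⟩
    obtain ⟨J, hJ⟩ := hr h hh (hlt.trans_le (min_le_left _ _))
    have h1 : h * (‖M‖ + 1) < 1 :=
      (lt_div_iff₀ (by positivity)).mp (hlt.trans_le (min_le_right _ _))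
    have hJn : ‖J‖ ≤ 1 := J.opNorm_le_bound zero_le_one fun x => by
      rw [one_mul]; exact hJ.norm_apply_le hG hh x
    have h2 : ‖h • (J * M)‖ < 1 := by
      rw [norm_smul, Real.norm_of_nonneg hh.le]
      have h3 : ‖J * M‖ ≤ 1 * ‖M‖ :=
        (norm_mul_le _ _).trans (mul_le_mul_of_nonneg_right hJn (norm_nonneg _))
      nlinarith [norm_nonneg M]
    obtain ⟨u, hu⟩ := ((ContinuousLinearMap.isUnit_iff_bijective).mp
      (Units.oneSub (h • (J * M)) h2).isUnit).2 (J f)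
    have hu' : u - h • J (M u) = J f := hu
    have hu1 : u = J (f + h • M u) := by
      rw [map_add, map_smul, ← hu', sub_add_cancel]
    refine ⟨(u, h⁻¹ • (u - f)), ?_, ?_⟩
    · have h4 := hJ (f + h • M u)
      rw [← hu1, mem_degGraph] at h4
      rw [mem_degGraph]
      convert h4 using 1
      simp only [zero_apply, sub_zero]
      rw [← sub_sub, smul_sub h⁻¹ (u - f), smul_smul, inv_mul_cancel₀ hh.ne', one_smul]
    · simp only
      rw [smul_smul, mul_inv_cancel₀ hh.ne', one_smul, sub_sub_cancel]

/-- The resolvent of `A₀ + M` preserves nonnegativity if the form of `M` does not change when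
passing to absolute values. -/
theorem resolvent_nonneg (ha : IsCoefficient a) {M : L2 →L[ℝ] L2}
    (hMs : ∀ x y, inner ℝ (M x) y = inner ℝ x (M y))
    (hM : ∀ u p, HasWeightedDeriv a u p → inner ℝ (M u) u ≤ ‖p‖ ^ 2)
    (hMabs : ∀ u, inner ℝ (M |u|) |u| = inner ℝ (M u) u) {h : ℝ} (hh : 0 < h) {J : L2 →L[ℝ] L2}
    (hJ : IsResolventAt (degGraph ha M) h J) {f : L2} (hf : 0 ≤ f) : 0 ≤ J f := by
  have hx := hJ f
  set u := J f with hu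
  set y := h⁻¹ • (u - f) with hy
  have hp := hasWeightedDeriv_of_mem_degGraph ha hx
  set p := -ContinuousLinearMap.adjoint (primitiveL ha) (y - M u) with hpd
  obtain ⟨r, hr, hrp⟩ := hp.abs ha
  set v := |u| with hv
  have hd := hr.sub ha hp
  have h1 : inner ℝ (y - M u) (v - u) = -inner ℝ p (r - p) := inner_of_mem_degGraph ha hx hd
  have h2 : f = u - h • y := by
    rw [hy, smul_smul, mul_inv_cancel₀ hh.ne', one_smul, sub_sub_cancel]
  have h3 : 0 ≤ inner ℝ f (v - u) := by
    rw [inner_eq_integral]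
    refine integral_nonneg_of_ae ?_
    filter_upwards [(Lp.coeFn_nonneg f).mpr hf, Lp.coeFn_sub v u, Lp.coeFn_abs u] with x h4 h5 h6
    rw [h5, Pi.sub_apply, hv, h6]
    exact mul_nonneg h4 (sub_nonneg.mpr (le_abs_self _))
  have h4 := hM _ _ hd
  have h5 : ‖v‖ = ‖u‖ := norm_abs_eq_norm u
  have h6 : ‖r‖ ^ 2 ≤ ‖p‖ ^ 2 := pow_le_pow_left₀ (norm_nonneg _) hrp 2
  have h7 := hMabs u
  rw [← hv] at h7
  have e1 : inner ℝ f (v - u) = inner ℝ u v - ‖u‖ ^ 2 - h * inner ℝ y (v - u) := by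
    rw [h2, inner_sub_left, inner_smul_left, inner_sub_right u, real_inner_self_eq_norm_sq]
    rfl
  have e2 : inner ℝ (y - M u) (v - u) =
      inner ℝ y (v - u) - (inner ℝ (M u) v - inner ℝ (M u) u) := by
    rw [inner_sub_left, inner_sub_right (M u)]
  have e3 : inner ℝ p (r - p) = inner ℝ p r - ‖p‖ ^ 2 := by
    rw [inner_sub_right, real_inner_self_eq_norm_sq]
  have e4 : ‖r - p‖ ^ 2 = ‖r‖ ^ 2 - 2 * inner ℝ p r + ‖p‖ ^ 2 := by
    rw [norm_sub_sq_real, real_inner_comm]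
  have e5 : inner ℝ (M (v - u)) (v - u) =
      inner ℝ (M v) v - 2 * inner ℝ (M u) v + inner ℝ (M u) u := by
    have e0 : inner ℝ (M v) u = inner ℝ (M u) v := by rw [hMs, real_inner_comm]
    rw [map_sub, inner_sub_left, inner_sub_right, inner_sub_right, e0]
    ring
  have e6 : ‖v - u‖ ^ 2 = ‖v‖ ^ 2 - 2 * inner ℝ u v + ‖u‖ ^ 2 := by
    rw [norm_sub_sq_real, real_inner_comm]
  -- Since `‖v‖ = ‖u‖`, the pairing of `f` with `v - u` is `-½ ‖v - u‖²` minus `h / 2` times the sum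
  -- of the form at `v - u` and `‖p‖² - ‖r‖²`, both nonnegative. But that pairing is itself
  -- nonnegative.
  have h8 : ‖v - u‖ ^ 2 ≤ 0 := by
    have h9 : 0 ≤ h * (‖r - p‖ ^ 2 - inner ℝ (M (v - u)) (v - u)) :=
      mul_nonneg hh.le (sub_nonneg.mpr h4)
    have h10 : h * (‖r‖ ^ 2 - ‖p‖ ^ 2) ≤ 0 :=
      mul_nonpos_of_nonneg_of_nonpos hh.le (sub_nonpos.mpr h6)
    have h11 : inner ℝ y (v - u) =
        ‖p‖ ^ 2 - inner ℝ p r + (inner ℝ (M u) v - inner ℝ (M u) u) := by linarith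
    rw [h11] at e1
    rw [e4, e5, h7] at h9
    rw [e6, h5] at *
    nlinarith
  have h12 : v - u = 0 := by
    have : ‖v - u‖ = 0 := by nlinarith [norm_nonneg (v - u)]
    exact norm_eq_zero.mp this
  rw [← sub_eq_zero.mp h12, hv]
  exact abs_nonneg u

end DegPar

/-! ### Multiplication operators, profiles and Picone's identity. -/

namespace DegPar

open Filter Topology

variable {a α : ℝ → ℝ}

/-- Multiplication by a bounded function as an operator on `L²(-1, 1)`. -/
noncomputable def mulL (hα : MemLp α ⊤ mu) : L2 →L[ℝ] L2 :=
  (ContinuousLinearMap.mul ℝ ℝ).holderL mu ⊤ 2 2 hα.toLp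

lemma coeFn_mulL (hα : MemLp α ⊤ mu) (u : L2) : mulL hα u =ᵐ[mu] fun x => α x * u x := by
  filter_upwards [(ContinuousLinearMap.mul ℝ ℝ).coeFn_holder (r := 2) hα.toLp u,
    hα.coeFn_toLp] with x h1 h2
  rw [← h2]
  exact h1

lemma inner_mulL (hα : MemLp α ⊤ mu) (u v : L2) :
    inner ℝ (mulL hα u) v = ∫ x, α x * u x * v x ∂mu := by
  rw [inner_eq_integral]
  refine integral_congr_ae ?_
  filter_upwards [coeFn_mulL hα u] with x hx
  rw [hx]

lemma mulL_symm (hα : MemLp α ⊤ mu) (u v : L2) :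
    inner ℝ (mulL hα u) v = inner ℝ u (mulL hα v) := by
  rw [real_inner_comm _ u, inner_mulL, inner_mulL]
  exact integral_congr_ae (Eventually.of_forall fun x => by ring)

lemma inner_mulL_abs (hα : MemLp α ⊤ mu) (u : L2) :
    inner ℝ (mulL hα |u|) |u| = inner ℝ (mulL hα u) u := by
  rw [inner_mulL, inner_mulL]
  refine integral_congr_ae ?_
  filter_upwards [Lp.coeFn_abs u] with x hx
  rw [hx, mul_assoc, abs_mul_abs_self, mul_assoc]

/-- A positive `C²` function that is constant near `±1`. -/
structure IsProfile (w : ℝ → ℝ) (s : ℝ) : Prop where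
  contDiff : ContDiff ℝ 2 w
  pos : ∃ η : ℝ, 0 < η ∧ ∀ x, η ≤ w x
  s_pos : 0 < s
  s_lt : s < 1
  deriv_eq : ∀ x, s ≤ |x| → deriv w =ᶠ[𝓝 x] 0

/-- The potential `-(a w')' / w` for which `w` is a stationary solution. -/
noncomputable def potential (a w : ℝ → ℝ) (x : ℝ) : ℝ := -deriv (fun y => a y * deriv w y) x / w x

namespace IsProfile

variable {w : ℝ → ℝ} {s : ℝ}

lemma pos' (hw : IsProfile w s) (x : ℝ) : 0 < w x := by
  obtain ⟨η, hη, h⟩ := hw.pos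
  exact hη.trans_le (h x)

lemma contDiff_deriv (hw : IsProfile w s) : ContDiff ℝ 1 (deriv w) :=
  ((contDiff_succ_iff_deriv (n := 1)).mp hw.contDiff).2.2

lemma differentiable (hw : IsProfile w s) : Differentiable ℝ w :=
  hw.contDiff.differentiable (by norm_num)

lemma memLp (hw : IsProfile w s) : MemLp w 2 mu := by
  obtain ⟨C, hC⟩ := (isCompact_Icc (a := (-1 : ℝ)) (b := 1)).exists_bound_of_continuousOn
    hw.contDiff.continuous.continuousOn
  refine MemLp.of_bound hw.contDiff.continuous.aestronglyMeasurable C ?_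
  filter_upwards [ae_restrict_mem measurableSet_Ioo] with x hx
  exact hC x (Ioo_subset_Icc_self hx)

lemma contDiffOn_flux (hw : IsProfile w s) (ha : IsCoefficient a) :
    ContDiffOn ℝ 1 (fun y => a y * deriv w y) (Icc (-1) 1) :=
  ha.contDiffOn.mul hw.contDiff_deriv.contDiffOn

lemma absolutelyContinuous_flux (hw : IsProfile w s) (ha : IsCoefficient a) :
    AbsolutelyContinuousOnInterval (fun y => a y * deriv w y) (-1) 1 := by
  refine ContDiffOn.absolutelyContinuousOnInterval ?_
  rw [uIcc_of_le (by norm_num)]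
  exact hw.contDiffOn_flux ha

/-- The flux is `C¹` on the closed interval, hence Lipschitz there. With the positive lower bound of
`w` this makes the potential an admissible `L^∞` control. -/
lemma exists_deriv_flux_bound (hw : IsProfile w s) (ha : IsCoefficient a) :
    ∃ C, ∀ x ∈ Ioo (-1 : ℝ) 1, ‖deriv (fun y => a y * deriv w y) x‖ ≤ C := by
  obtain ⟨K, hK⟩ := (hw.contDiffOn_flux ha).exists_lipschitzOnWith (by decide) (convex_Icc _ _)
    isCompact_Icc
  exact ⟨K, fun x hx => norm_deriv_le_of_lipschitzOn (Icc_mem_nhds hx.1 hx.2) hK⟩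

lemma memLp_potential (hw : IsProfile w s) (ha : IsCoefficient a) :
    MemLp (potential a w) ⊤ mu := by
  obtain ⟨C, hC⟩ := hw.exists_deriv_flux_bound ha
  obtain ⟨η, hη, hwη⟩ := hw.pos
  refine memLp_top_of_bound (((measurable_deriv _).neg.div
    hw.contDiff.continuous.measurable).aestronglyMeasurable) (C / η) ?_
  filter_upwards [ae_restrict_mem measurableSet_Ioo] with x hx
  rw [potential, norm_div, norm_neg, Real.norm_of_nonneg (hw.pos' x).le]
  exact div_le_div₀ ((norm_nonneg _).trans (hC x hx)) (hC x hx) hη (hwη x)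

lemma mem_degGraph (hw : IsProfile w s) (ha : IsCoefficient a) :
    (hw.memLp.toLp, (0 : L2)) ∈ degGraph ha (mulL (hw.memLp_potential ha)) := by
  rw [DegPar.mem_degGraph]
  obtain ⟨C, hC⟩ := (isCompact_Icc (a := (-1 : ℝ)) (b := 1)).exists_bound_of_continuousOn
    (ha.contDiffOn.continuousOn.sqrt.mul hw.contDiff_deriv.continuous.continuousOn)
  refine ⟨w, fun y => a y * deriv w y, ?_, hw.memLp.coeFn_toLp, ?_,
    hw.absolutelyContinuous_flux ha, ae_eq_refl _, by simp [ha.left], by simp [ha.right], ?_⟩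
  · intro c d _ _ _
    exact (hw.contDiff.of_le (by norm_num)).contDiffOn.absolutelyContinuousOnInterval
  · refine MemLp.of_bound ((ha.continuousOn_Ioo.sqrt.mul
      hw.contDiff_deriv.continuous.continuousOn).aestronglyMeasurable measurableSet_Ioo) C ?_
    filter_upwards [ae_restrict_mem measurableSet_Ioo] with x hx
    exact hC x (Ioo_subset_Icc_self hx)
  · simp only [zero_sub]
    filter_upwards [Lp.coeFn_neg (mulL (hw.memLp_potential ha) hw.memLp.toLp),
      coeFn_mulL (hw.memLp_potential ha) hw.memLp.toLp, hw.memLp.coeFn_toLp] with x h1 h2 h3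
    rw [h1, Pi.neg_apply, h2, h3, potential, div_mul_cancel₀ _ (hw.pos' x).ne', neg_neg]

/-- **Picone's identity** for the degenerate operator. -/
lemma picone (hw : IsProfile w s) (ha : IsCoefficient a) {u p : L2} {f : ℝ → ℝ} (hf : LocAC f)
    (huf : u =ᵐ[mu] f) (hpf : p =ᵐ[mu] fun x => √(a x) * deriv f x) :
    Integrable (fun x => a x * (deriv f x - f x * (deriv w x / w x)) ^ 2) mu ∧
      ‖p‖ ^ 2 - inner ℝ (mulL (hw.memLp_potential ha) u) u =
        ∫ x, a x * (deriv f x - f x * (deriv w x / w x)) ^ 2 ∂mu := by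
  set q : ℝ → ℝ := fun y => a y * deriv w y with hq
  set θ : ℝ → ℝ := fun x => f x * f x * (w x)⁻¹ with hθ
  -- `N` is the derivative of `q f² / w`. It has zero integral because `q` vanishes outside `(-s,
  -- s)`, so no information on `f` near `±1` is needed.
  set N : ℝ → ℝ := fun x => deriv q x * θ x + q x * deriv θ x with hN
  have hs := hw.s_pos
  have hs1 := hw.s_lt
  have hsub : Icc (-s) s ⊆ Ioo (-1 : ℝ) 1 := Icc_subset_Ioo_of_lt hs1
  have hq0 : ∀ x, s ≤ |x| → q =ᶠ[𝓝 x] fun _ => 0 := fun x hx => by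
    filter_upwards [hw.deriv_eq x hx] with y hy
    simp [hq, hy]
  have hqac : AbsolutelyContinuousOnInterval q (-s) s :=
    (hw.absolutelyContinuous_flux ha).mono (by
      rw [uIcc_of_le (by linarith), uIcc_of_le (by norm_num)]
      exact hsub.trans Ioo_subset_Icc_self)
  have hfac := hf (-s) s (by linarith) (by linarith) hs1
  have hinv : ContDiff ℝ 1 fun x => (w x)⁻¹ :=
    (hw.contDiff.of_le (by norm_num)).inv fun x => (hw.pos' x).ne'
  have hθac : AbsolutelyContinuousOnInterval θ (-s) s :=
    (hfac.fun_mul hfac).fun_mul hinv.contDiffOn.absolutelyContinuousOnInterval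
  have hNi : IntervalIntegrable N volume (-s) s :=
    (hqac.intervalIntegrable_deriv.mul_continuousOn hθac.continuousOn).add
      (hθac.intervalIntegrable_deriv.continuousOn_mul hqac.continuousOn)
  have hNout : ∀ x, x ∉ Ioc (-s) s → N x = 0 := by
    intro x hx
    have hx' : s ≤ |x| := by
      by_contra hc
      push Not at hc
      have := abs_lt.mp hc
      exact hx ⟨this.1, this.2.le⟩
    simp only [hN, (hq0 x hx').deriv_eq, deriv_const, (hq0 x hx').eq_of_nhds, zero_mul, add_zero]
  have hNint : Integrable N mu := by
    have h1 : IntegrableOn N (Ioc (-s) s) :=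
      (intervalIntegrable_iff_integrableOn_Ioc_of_le (by linarith)).mp hNi
    exact (h1.integrable_of_forall_notMem_eq_zero hNout).mono_measure Measure.restrict_le_self
  have hN0 : ∫ x, N x ∂mu = 0 := by
    have h1 := hqac.integral_deriv_mul_eq_sub hθac
    rw [(hq0 s (le_abs_self s)).eq_of_nhds,
      (hq0 (-s) (by rw [abs_neg]; exact le_abs_self s)).eq_of_nhds, zero_mul, zero_mul, sub_zero,
      intervalIntegral.integral_of_le (by linarith)] at h1
    rw [← h1]
    exact setIntegral_eq_of_subset_of_forall_sdiff_eq_zero measurableSet_Ioo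
      (Ioc_subset_Icc_self.trans hsub) fun x hx => hNout x hx.2
  have hpt : ∀ᵐ x ∂mu, a x * (deriv f x - f x * (deriv w x / w x)) ^ 2 =
      p x ^ 2 - N x - potential a w x * u x * u x := by
    filter_upwards [huf, hpf, hf.ae_differentiableAt, ae_restrict_mem measurableSet_Ioo]
      with x h1 h2 h3 hx
    have hwx := (hw.pos' x).ne'
    have h4 : HasDerivAt θ ((deriv f x * f x + f x * deriv f x) * (w x)⁻¹ +
        f x * f x * (-deriv w x / w x ^ 2)) x :=
      (h3.hasDerivAt.mul h3.hasDerivAt).mul ((hw.differentiable x).hasDerivAt.inv hwx)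
    have h5 : potential a w x = -deriv q x / w x := rfl
    rw [h1, h2, mul_pow, Real.sq_sqrt (ha.pos x hx).le, h5]
    have h6 : N x = deriv q x * θ x + q x * _ := congrArg (fun y => deriv q x * θ x + q x * y) h4.deriv
    rw [h6]
    simp only [hq, hθ]
    field_simp
    ring
  have hi1 : Integrable (fun x => p x ^ 2) mu := (Lp.memLp p).integrable_sq
  have hi2 : Integrable (fun x => potential a w x * u x * u x) mu := by
    refine ((Lp.memLp (mulL (hw.memLp_potential ha) u)).integrable_mul (Lp.memLp u)).congr ?_
    filter_upwards [coeFn_mulL (hw.memLp_potential ha) u] with x hx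
    rw [Pi.mul_apply, hx]
  refine ⟨((hi1.sub hNint).sub hi2).congr (hpt.mono fun x hx => hx.symm), ?_⟩
  have hi3 : Integrable (fun x => p x ^ 2 - N x) mu := hi1.sub hNint
  rw [integral_congr_ae hpt, integral_sub hi3 hi2, integral_sub hi1 hNint, hN0,
    sub_zero, norm_sq_eq_integral, inner_mulL]

lemma inner_mulL_le (hw : IsProfile w s) (ha : IsCoefficient a) (u p : L2)
    (hu : HasWeightedDeriv a u p) : inner ℝ (mulL (hw.memLp_potential ha) u) u ≤ ‖p‖ ^ 2 := by
  obtain ⟨f, hf, huf, hpf⟩ := hu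
  rw [← sub_nonneg, (hw.picone ha hf huf hpf).2]
  refine integral_nonneg_of_ae ?_
  filter_upwards [ae_restrict_mem measurableSet_Ioo] with x hx
  exact mul_nonneg (ha.pos x hx).le (sq_nonneg _)

/-- The profile spans the kernel of the operator with its potential. -/
lemma eq_smul_of_mem_kernel (hw : IsProfile w s) (ha : IsCoefficient a) {u : L2}
    (hu : (u, (0 : L2)) ∈ degGraph ha (mulL (hw.memLp_potential ha))) :
    ∃ c : ℝ, u = c • hw.memLp.toLp := by
  obtain ⟨f, hf, huf, hpf⟩ := hasWeightedDeriv_of_mem_degGraph ha hu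
  have h1 := norm_sq_of_mem_degGraph ha hu
  obtain ⟨hint, h2⟩ := hw.picone ha hf huf hpf
  rw [h1] at h2
  simp only [inner_zero_right, neg_zero, zero_add, sub_self] at h2
  have hnn : 0 ≤ᵐ[mu] fun x => a x * (deriv f x - f x * (deriv w x / w x)) ^ 2 := by
    filter_upwards [ae_restrict_mem measurableSet_Ioo] with x hx
    exact mul_nonneg (ha.pos x hx).le (sq_nonneg _)
  have h3 := (integral_eq_zero_iff_of_nonneg_ae hnn hint).mp h2.symm
  have hinv : ContDiff ℝ 1 fun x => (w x)⁻¹ :=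
    (hw.contDiff.of_le (by norm_num)).inv fun x => (hw.pos' x).ne'
  -- Vanishing of the Picone integrand means `(f / w)' = 0`, and local absolute continuity makes `f
  -- / w` constant.
  have hd : ∀ᵐ x ∂mu, HasDerivAt (fun x => f x * (w x)⁻¹) 0 x := by
    filter_upwards [h3, hf.ae_differentiableAt, ae_restrict_mem measurableSet_Ioo]
      with x h4 h5 hx
    have hwx := (hw.pos' x).ne'
    have h6 : HasDerivAt (fun x => f x * (w x)⁻¹)
        (deriv f x * (w x)⁻¹ + f x * (-deriv w x / w x ^ 2)) x :=
      h5.hasDerivAt.mul ((hw.differentiable x).hasDerivAt.inv hwx)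
    have h7 : deriv f x - f x * (deriv w x / w x) = 0 := by
      have : a x * (deriv f x - f x * (deriv w x / w x)) ^ 2 = 0 := h4
      simpa [(ha.pos x hx).ne'] using this
    refine h6.congr_deriv ?_
    rw [sub_eq_zero.mp h7]
    field_simp
    ring
  have hconst : ∀ x ∈ Ioo (-1 : ℝ) 1, f x * (w x)⁻¹ = f 0 * (w 0)⁻¹ := by
    intro x hx
    have hac : AbsolutelyContinuousOnInterval (fun x => f x * (w x)⁻¹) 0 x := by
      have h8 := hf (min 0 x) (max 0 x) (lt_min (by norm_num) hx.1) min_le_max (max_lt one_pos hx.2)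
      have h9 := h8.fun_mul (hinv.contDiffOn (s := uIcc (min 0 x)
        (max 0 x))).absolutelyContinuousOnInterval
      exact h9.mono (by rw [uIcc_of_le min_le_max]; rfl)
    obtain ⟨C, hC⟩ := hac.const_of_ae_hasDerivAt_zero (by
      filter_upwards [(ae_restrict_iff' measurableSet_Ioo).mp hd] with y hy hyx
      exact hy (uIcc_zero_subset hx hyx))
    rw [hC x right_mem_uIcc, hC 0 left_mem_uIcc]
  refine ⟨f 0 * (w 0)⁻¹, Lp.ext ?_⟩
  filter_upwards [huf, ae_restrict_mem measurableSet_Ioo, hw.memLp.coeFn_toLp,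
    Lp.coeFn_smul (f 0 * (w 0)⁻¹) hw.memLp.toLp] with x h4 hx h5 h6
  rw [h6, Pi.smul_apply, h5, ← hconst x hx, smul_eq_mul, mul_assoc,
    inv_mul_cancel₀ (hw.pos' x).ne', mul_one]
  exact h4

end IsProfile

end DegPar

/-! ### Approximation of nonnegative functions by profiles. -/

namespace DegPar

open Filter Topology

lemma norm_one_le : ‖one‖ ≤ 2 := by
  have h1 : ‖one‖ ^ 2 = 2 := by
    rw [← real_inner_self_eq_norm_sq, inner_one, integral_congr_ae coeFn_one]
    rw [integral_mu_eq, intervalIntegral.integral_const]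
    norm_num
  nlinarith [norm_nonneg one]

lemma norm_toLp_sub_le {f g : ℝ → ℝ} (hf : MemLp f 2 mu) (hg : MemLp g 2 mu) {ε : ℝ} (hε : 0 ≤ ε)
    (h : eLpNorm (f - g) 2 mu ≤ ENNReal.ofReal ε) : ‖hf.toLp - hg.toLp‖ ≤ ε := by
  rw [← MemLp.toLp_sub, Lp.norm_toLp]
  exact ENNReal.toReal_le_of_le_ofReal hε h

/-- `L²` functions can be approximated by smooth functions supported in a compact subset of
`(-1, 1)`. -/
lemma exists_contDiff_support_approx (v : L2) {ε : ℝ} (hε : 0 < ε) :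
    ∃ (g : ℝ → ℝ) (s : ℝ) (hg : MemLp g 2 mu), 0 < s ∧ s < 1 ∧ ContDiff ℝ 2 g ∧
      (∀ x, s ≤ |x| → g x = 0) ∧ ‖hg.toLp - v‖ ≤ ε := by
  obtain ⟨δ, hδ, hδv⟩ := (Lp.memLp v).eLpNorm_indicator_le (by norm_num) (by norm_num)
    (half_pos hε)
  obtain ⟨s, hs, hs1, hsδ⟩ : ∃ s : ℝ, 0 < s ∧ s < 1 ∧ 2 * (1 - s) ≤ δ := by
    refine ⟨max (1 / 2) (1 - δ / 2), lt_max_of_lt_left (by norm_num),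
      max_lt (by norm_num) (by linarith), ?_⟩
    linarith [le_max_right (1 / 2) (1 - δ / 2)]
  set f : ℝ → ℝ := (Icc (-s) s).indicator v with hf
  have hfm : MemLp f 2 mu := (Lp.memLp v).indicator measurableSet_Icc
  have h1 : eLpNorm (f - (v : ℝ → ℝ)) 2 mu ≤ ENNReal.ofReal (ε / 2) := by
    have e1 : f - (v : ℝ → ℝ) = -((Icc (-s) s)ᶜ.indicator v) := by
      rw [indicator_compl, hf]; abel
    rw [e1, eLpNorm_neg]
    refine hδv _ measurableSet_Icc.compl ?_
    rw [Measure.restrict_apply measurableSet_Icc.compl]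
    have hsub : (Icc (-s) s)ᶜ ∩ Ioo (-1 : ℝ) 1 ⊆ Ioc (-1) (-s) ∪ Ico s 1 := by
      rintro x ⟨hx1, hx2⟩
      simp only [mem_compl_iff, mem_Icc, not_and_or, not_le] at hx1
      rcases hx1 with hx1 | hx1
      · exact Or.inl ⟨hx2.1, hx1.le⟩
      · exact Or.inr ⟨hx1.le, hx2.2⟩
    refine (measure_mono hsub).trans ((measure_union_le _ _).trans ?_)
    rw [Real.volume_Ioc, Real.volume_Ico, ← ENNReal.ofReal_add (by linarith) (by linarith)]
    exact ENNReal.ofReal_le_ofReal (by linarith)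
  obtain ⟨g, -, hg, hgf⟩ := hfm.exist_eLpNorm_sub_le (by norm_num) (by norm_num) (half_pos hε)
  have hs2 : s < (1 + s) / 2 := by linarith
  let χ : ContDiffBump (0 : ℝ) := ⟨s, (1 + s) / 2, hs, hs2⟩
  have hχ1 : ∀ x ∈ Icc (-s) s, χ x = 1 := fun x hx =>
    χ.one_of_mem_closedBall (by rw [Real.closedBall_eq_Icc]; simpa using hx)
  have hgχ : ContDiff ℝ 2 fun x => χ x * g x := χ.contDiff.mul (hg.of_le (by exact_mod_cast le_top))
  -- The cutoff costs nothing: `χ = 1` on `[-s, s]`, and elsewhere `f = 0` and `χ ≤ 1`.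
  have hle : ∀ x, ‖χ x * g x - f x‖ ≤ ‖f x - g x‖ := by
    intro x
    by_cases hx : x ∈ Icc (-s) s
    · rw [hχ1 x hx, one_mul, norm_sub_rev]
    · rw [hf, indicator_of_notMem hx, sub_zero, zero_sub, norm_neg, norm_mul,
        Real.norm_of_nonneg χ.nonneg]
      exact mul_le_of_le_one_left (norm_nonneg _) χ.le_one
  have h2 : eLpNorm ((fun x => χ x * g x) - f) 2 mu ≤ ENNReal.ofReal (ε / 2) :=
    (eLpNorm_mono hle).trans hgf
  have hgm : MemLp (fun x => χ x * g x) 2 mu := by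
    obtain ⟨C, hC⟩ := (isCompact_Icc (a := (-1 : ℝ)) (b := 1)).exists_bound_of_continuousOn
      hgχ.continuous.continuousOn
    refine MemLp.of_bound hgχ.continuous.aestronglyMeasurable C ?_
    filter_upwards [ae_restrict_mem measurableSet_Ioo] with x hx
    exact hC x (Ioo_subset_Icc_self hx)
  refine ⟨_, (1 + s) / 2, hgm, by linarith, by linarith, hgχ, fun x hx => ?_, ?_⟩
  · have : χ x = 0 := χ.zero_of_le_dist (by rw [Real.dist_eq, sub_zero]; exact hx)
    simp only [this, zero_mul]
  · have h3 := norm_toLp_sub_le hgm hfm (half_pos hε).le h2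
    have h4 := norm_toLp_sub_le hfm (Lp.memLp v) (half_pos hε).le h1
    rw [Lp.toLp_coeFn] at h4
    have h5 := norm_sub_le_norm_sub_add_norm_sub hgm.toLp hfm.toLp v
    linarith

/-- Nonnegative `L²` functions can be approximated by profiles. -/
lemma exists_isProfile_approx (v : L2) (hv : 0 ≤ v) {ε : ℝ} (hε : 0 < ε) :
    ∃ (w : ℝ → ℝ) (s : ℝ) (hw : IsProfile w s), ‖hw.memLp.toLp - v‖ ≤ ε := by
  obtain ⟨g, s, hgm, hs, hs1, hg, hg0, hgv⟩ := exists_contDiff_support_approx v (half_pos hε)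
  -- The profile `√(g² + η²)` differs from `|g|` by at most `η` pointwise, hence by at most `2 η = ε
  -- / 2` in norm; taking absolute values does not increase the distance to `v ≥ 0`.
  set η := ε / 4 with hη
  have hηpos : 0 < η := by positivity
  have hpos : ∀ x, 0 < g x ^ 2 + η ^ 2 := fun x => by positivity
  have hw : IsProfile (fun x => √(g x ^ 2 + η ^ 2)) ((1 + s) / 2) := by
    refine ⟨((hg.pow 2).add contDiff_const).sqrt fun x => (hpos x).ne', ⟨η, hηpos, fun x => ?_⟩,
      by linarith, by linarith, fun x hx => ?_⟩
    · exact Real.le_sqrt_of_sq_le (by linarith [sq_nonneg (g x)])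
    · have h1 : (fun y => √(g y ^ 2 + η ^ 2)) =ᶠ[𝓝 x] fun _ => √(0 ^ 2 + η ^ 2) := by
        have h2 : ∀ᶠ y in 𝓝 x, s < |y| :=
          continuous_abs.continuousAt.eventually (lt_mem_nhds (by linarith))
        filter_upwards [h2] with y hy
        rw [hg0 y hy.le]
      refine h1.deriv.trans ?_
      simp only [deriv_const']
      rfl
  refine ⟨_, _, hw, ?_⟩
  have h1 : ‖hw.memLp.toLp - |hgm.toLp|‖ ≤ η * ‖one‖ := by
    have h2 : ‖η • one‖ = η * ‖one‖ := by rw [norm_smul, Real.norm_of_nonneg hηpos.le]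
    rw [← h2]
    refine Lp.norm_le_norm_of_ae_le ?_
    filter_upwards [Lp.coeFn_sub hw.memLp.toLp |hgm.toLp|, hw.memLp.coeFn_toLp,
      Lp.coeFn_abs hgm.toLp, hgm.coeFn_toLp, Lp.coeFn_smul η one, coeFn_one] with x e1 e2 e3 e4 e5 e6
    rw [e1, Pi.sub_apply, e2, e3, e4, e5, Pi.smul_apply, e6, smul_eq_mul, mul_one,
      Real.norm_of_nonneg hηpos.le, Real.norm_of_nonneg]
    · rw [sub_le_iff_le_add]
      refine Real.sqrt_le_iff.mpr ⟨by positivity, ?_⟩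
      nlinarith [sq_abs (g x), abs_nonneg (g x)]
    · rw [sub_nonneg]
      exact Real.le_sqrt_of_sq_le (by rw [sq_abs]; linarith [sq_nonneg η])
  have h3 : ‖|hgm.toLp| - v‖ ≤ ε / 2 := by
    have h4 := norm_abs_sub_abs hgm.toLp v
    rw [abs_of_nonneg hv] at h4
    exact h4.trans hgv
  have h5 := norm_sub_le_norm_sub_add_norm_sub hw.memLp.toLp |hgm.toLp| v
  have h6 := mul_le_mul_of_nonneg_left norm_one_le hηpos.le
  linarith

end DegPar

/-! ### Weak solutions for the shifted potential. -/

namespace DegPar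

open Filter Topology

variable {a w : ℝ → ℝ} {s : ℝ}

lemma IsProfile.memLp_potential_add (hw : IsProfile w s) (ha : IsCoefficient a) (δ : ℝ) :
    MemLp (fun x => potential a w x + δ) ⊤ mu :=
  (hw.memLp_potential ha).add (memLp_const δ)

lemma IsProfile.weak_rhs (hw : IsProfile w s) (ha : IsCoefficient a) (δ : ℝ) (u φ z : L2) :
    inner ℝ u z + ∫ x, (potential a w x + δ) * u x * φ x ∂mu =
      inner ℝ u (z + mulL (hw.memLp_potential ha) φ) + δ * inner ℝ u φ := by
  have h1 : mulL (hw.memLp_potential_add ha δ) u = mulL (hw.memLp_potential ha) u + δ • u := by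
    refine Lp.ext ?_
    filter_upwards [coeFn_mulL (hw.memLp_potential_add ha δ) u, coeFn_mulL (hw.memLp_potential ha) u,
      Lp.coeFn_add (mulL (hw.memLp_potential ha) u) (δ • u), Lp.coeFn_smul δ u] with x e1 e2 e3 e4
    rw [e1, e3, Pi.add_apply, e2, e4, Pi.smul_apply, smul_eq_mul, add_mul]
  rw [← inner_mulL (hw.memLp_potential_add ha δ), h1, inner_add_left, inner_smul_left, mulL_symm,
    inner_add_right, add_assoc]
  rfl

lemma IsProfile.isDissipativeGraph (hw : IsProfile w s) (ha : IsCoefficient a) :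
    IsDissipativeGraph (degGraph ha (mulL (hw.memLp_potential ha))) :=
  isDissipativeGraph_degGraph ha (mulL_symm _) (hw.inner_mulL_le ha)

lemma add_mulL_mem (hw : IsProfile w s) (ha : IsCoefficient a) {φ z : L2} (h : IsDegOp a φ z) :
    (φ, z + mulL (hw.memLp_potential ha) φ) ∈ degGraph ha (mulL (hw.memLp_potential ha)) := by
  rw [mem_degGraph, add_sub_cancel_right]
  exact h

/-- Semigroup orbits belong to `L²(0, S; H¹ₐ(-1, 1))`. -/
lemma exists_memLp_hasWeightedDeriv (ha : IsCoefficient a) {M : L2 →L[ℝ] L2}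
    (hG : IsDissipativeGraph (degGraph ha M)) {T : ℝ → L2 →L[ℝ] L2}
    (hT : IsSemigroupOf (degGraph ha M) T) (v₀ : L2) {S : ℝ} (hS : 0 < S) :
    ∃ p : ℝ → L2, MemLp p 2 ((volume : Measure ℝ).restrict (Ioo 0 S)) ∧
      ∀ᵐ t ∂(volume : Measure ℝ).restrict (Ioo 0 S), HasWeightedDeriv a (T t v₀) (p t) := by
  obtain ⟨P, hP⟩ : ∃ P : L2 × L2 →L[ℝ] L2, ∀ x,
      P x = -ContinuousLinearMap.adjoint (primitiveL ha) (x.2 - M x.1) :=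
    ⟨-(ContinuousLinearMap.adjoint (primitiveL ha) ∘L
      (ContinuousLinearMap.snd ℝ L2 L2 - M ∘L ContinuousLinearMap.fst ℝ L2 L2)), fun _ => rfl⟩
  have h2 : ∀ u, inner ℝ (M u) u ≤ ‖M‖ * ‖u‖ ^ 2 := fun u => by
    refine (real_inner_le_norm _ _).trans ?_
    rw [pow_two, ← mul_assoc]
    exact mul_le_mul_of_nonneg_right (M.le_opNorm _) (norm_nonneg _)
  have hV := isClosed_hasWeightedDeriv ha
  have h3 : ∀ x ∈ degGraph ha M, HasWeightedDeriv a x.1 (P x) := fun x hx => by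
    rw [hP]
    exact hasWeightedDeriv_of_mem_degGraph ha hx
  have h4 : ∀ x ∈ degGraph ha M, ‖P x‖ ^ 2 ≤ -inner ℝ x.1 x.2 + ‖M‖ * ‖x.1‖ ^ 2 := fun x hx => by
    rw [hP, norm_sq_of_mem_degGraph ha hx]
    linarith [h2 x.1]
  exact hT.exists_memLp hG P hV (norm_nonneg M) h3 h4 v₀ hS

lemma smul_nonneg_L2 {c : ℝ} (hc : 0 ≤ c) {u : L2} (hu : 0 ≤ u) : 0 ≤ c • u := by
  rw [← Lp.coeFn_nonneg]
  filter_upwards [(Lp.coeFn_nonneg u).mpr hu, Lp.coeFn_smul c u] with x h1 h2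
  rw [h2]
  exact mul_nonneg hc h1

/-- The rescaled semigroup orbit solves the problem with the shifted potential. -/
theorem IsProfile.isWeakSolution (hw : IsProfile w s) (ha : IsCoefficient a)
    {T : ℝ → L2 →L[ℝ] L2}
    (hT : IsSemigroupOf (degGraph ha (mulL (hw.memLp_potential ha))) T) (δ : ℝ) (v₀ : L2) {S : ℝ}
    (hS : 0 < S) :
    IsWeakSolution a (fun _ x => potential a w x + δ) v₀ S
      (fun t => Real.exp (δ * t) • T t v₀) := by
  set M := mulL (hw.memLp_potential ha) with hM
  have hG := hw.isDissipativeGraph ha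
  have hvc : Continuous fun t => Real.exp (δ * t) • T t v₀ :=
    (by fun_prop : Continuous fun t => Real.exp (δ * t)).smul (hT.cont v₀)
  -- Symmetry moves the semigroup onto the test function, which lies in the domain, so the pairing
  -- is differentiable for every `v₀` in `L²`.
  have hd : ∀ φ z, IsDegOp a φ z → ∀ t, 0 ≤ t → HasDerivWithinAt
      (fun t => inner ℝ (Real.exp (δ * t) • T t v₀) φ)
      (inner ℝ (Real.exp (δ * t) • T t v₀) (z + M φ) +
        δ * inner ℝ (Real.exp (δ * t) • T t v₀) φ) (Ici 0) t := by
    intro φ z hφ t ht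
    have h1 := hT.deriv _ (add_mulL_mem hw ha hφ) t ht
    have h2 : HasDerivWithinAt (fun t => Real.exp (δ * t)) (Real.exp (δ * t) * δ) (Ici 0) t := by
      have := ((hasDerivAt_id t).const_mul δ).exp
      simpa using this.hasDerivWithinAt
    have h3 := h2.mul ((hasDerivWithinAt_const t (Ici 0) v₀).inner ℝ h1)
    simp only [inner_zero_left, add_zero] at h3
    refine (h3.congr (fun r _ => ?_) ?_).congr_deriv ?_
    · rw [inner_smul_left, hT.symm]; rfl
    · rw [inner_smul_left, hT.symm]; rfl
    · rw [inner_smul_left, inner_smul_left, hT.symm, hT.symm, ← hM]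
      simp only [conj_trivial]
      ring
  refine ⟨?_, hvc.continuousOn, ?_, ?_, ?_⟩
  · simp [hT.zero]
  · obtain ⟨p, hp, hpT⟩ := exists_memLp_hasWeightedDeriv ha hG hT v₀ hS
    refine ⟨fun t => Real.exp (δ * t) • p t, ?_, ?_⟩
    · have hec : Continuous fun t : ℝ => Real.exp (δ * t) := by fun_prop
      obtain ⟨C, hC⟩ := (isCompact_Icc (a := (0 : ℝ)) (b := S)).exists_bound_of_continuousOn
        hec.continuousOn
      have h1 : MemLp (fun t : ℝ => Real.exp (δ * t)) ⊤
          ((volume : Measure ℝ).restrict (Ioo 0 S)) := by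
        refine memLp_top_of_bound hec.aestronglyMeasurable C ?_
        filter_upwards [ae_restrict_mem measurableSet_Ioo] with x hx
        exact hC x (Ioo_subset_Icc_self hx)
      exact hp.smul h1
    · filter_upwards [hpT] with t ht
      exact HasWeightedDeriv.smul ha ht _
  · intro φ z hφ
    have hc : Continuous fun t => inner ℝ (Real.exp (δ * t) • T t v₀) (z + M φ) +
        δ * inner ℝ (Real.exp (δ * t) • T t v₀) φ :=
      (hvc.inner continuous_const).add ((hvc.inner continuous_const).const_mul δ)
    obtain ⟨C, hC⟩ := (isCompact_Icc (a := (0 : ℝ)) (b := S)).exists_bound_of_continuousOn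
      hc.continuousOn
    refine LipschitzOnWith.absolutelyContinuousOnInterval (K := C.toNNReal) ?_
    rw [uIcc_of_le hS.le]
    refine (convex_Icc (0 : ℝ) S).lipschitzOnWith_of_nnnorm_hasDerivWithin_le
      (fun t ht => (hd φ z hφ t ht.1).mono Icc_subset_Ici_self) fun t ht => ?_
    rw [← NNReal.coe_le_coe, coe_nnnorm]
    exact (hC t ht).trans (Real.le_coe_toNNReal C)
  · intro φ z hφ
    filter_upwards [ae_restrict_mem measurableSet_Ioo] with t ht
    rw [hw.weak_rhs ha]
    exact (hd φ z hφ t ht.1.le).hasDerivAt (Ici_mem_nhds ht.1)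

/-- Weak solutions are unique. -/
theorem IsProfile.weakSolution_unique (hw : IsProfile w s) (ha : IsCoefficient a) {δ : ℝ} {v₀ : L2}
    {S : ℝ} (hS : 0 < S) {u v : ℝ → L2}
    (hu : IsWeakSolution a (fun _ x => potential a w x + δ) v₀ S u)
    (hv : IsWeakSolution a (fun _ x => potential a w x + δ) v₀ S v) : EqOn u v (Icc 0 S) := by
  intro t ht
  rw [← sub_eq_zero]
  refine (hw.isDissipativeGraph ha).eq_zero_of_weak (δ := δ) hS (z := fun t => u t - v t)
    (by simp only [hu.initial, hv.initial, sub_self]) (hu.continuousOn.sub hv.continuousOn)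
    ?_ ?_ t ht
  · intro x hx
    simp only [inner_sub_left]
    exact (hu.absolutelyContinuous _ _ hx).sub (hv.absolutelyContinuous _ _ hx)
  · intro x hx
    filter_upwards [hu.weak_eq _ _ hx, hv.weak_eq _ _ hx] with t h1 h2
    rw [hw.weak_rhs ha, sub_add_cancel] at h1 h2
    simp only [inner_sub_left]
    refine (h1.sub h2).congr_deriv ?_
    ring

/-- Strict positivity of `w` is decisive: a zero integral of `v w` would force `v = 0`. This makes
the limiting multiple of `w` positive. -/
lemma IsProfile.inner_pos (hw : IsProfile w s) {v : L2} (hv : 0 ≤ v) (hv0 : v ≠ 0) :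
    0 < inner ℝ v hw.memLp.toLp := by
  have h1 : inner ℝ v hw.memLp.toLp = ∫ x, v x * w x ∂mu := by
    rw [inner_eq_integral]
    refine integral_congr_ae ?_
    filter_upwards [hw.memLp.coeFn_toLp] with x hx
    rw [hx]
  have hnn : 0 ≤ᵐ[mu] fun x => v x * w x := by
    filter_upwards [(Lp.coeFn_nonneg v).mpr hv] with x hx
    exact mul_nonneg hx (hw.pos' x).le
  rw [h1]
  refine lt_of_le_of_ne (integral_nonneg_of_ae hnn) fun h => hv0 ?_
  have hi : Integrable (fun x => v x * w x) mu := (Lp.memLp v).integrable_mul hw.memLp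
  refine Lp.ext ?_
  filter_upwards [(integral_eq_zero_iff_of_nonneg_ae hnn hi).mp h.symm, Lp.coeFn_zero ℝ 2 mu]
    with x hx h0
  rw [h0]
  exact (mul_eq_zero.mp hx).resolve_right (hw.pos' x).ne'

end DegPar

/-! ### Choice of the control and the final time. -/

theorem theorem1p3 (a : ℝ → ℝ) (ha : DegPar.IsCoefficient a)
    (ε : ℝ) (hε : 0 < ε)
    (v₀ vd : DegPar.L2) (hv₀ : 0 ≤ v₀) (hv₀_ne : v₀ ≠ 0) (hvd : 0 ≤ vd) :
    ∃ T : ℝ, 0 < T ∧ ∃ α : ℝ → ℝ, MemLp α ⊤ DegPar.mu ∧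
      ∃ v : ℝ → DegPar.L2,
        (∀ S : ℝ, 0 < S →
          DegPar.IsWeakSolution a (fun _ x => α x) v₀ S v ∧
          ∀ w : ℝ → DegPar.L2,
            DegPar.IsWeakSolution a (fun _ x => α x) v₀ S w → EqOn w v (Icc 0 S)) ∧
        ‖v T - vd‖ ≤ ε ∧
        ∀ t : ℝ, 0 ≤ t → 0 ≤ v t := by
  obtain ⟨w, s, hw, hwd⟩ := DegPar.exists_isProfile_approx vd hvd (half_pos hε)
  set W : DegPar.L2 := hw.memLp.toLp with hW
  have hG := hw.isDissipativeGraph ha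
  obtain ⟨T, hT, hcone⟩ := hG.exists_semigroup
  have hTnn : ∀ t, 0 ≤ T t v₀ := by
    intro t
    refine mem_Ici.mp (hcone (Ici 0) isClosed_Ici self_mem_Ici
      (fun x hx y hy => mem_Ici.mpr (add_nonneg (mem_Ici.mp hx) (mem_Ici.mp hy)))
      (fun c hc x hx => mem_Ici.mpr (DegPar.smul_nonneg_L2 hc (mem_Ici.mp hx)))
      (fun h J hh hJ x hx => mem_Ici.mpr ?_) t v₀ (mem_Ici.mpr hv₀))
    exact DegPar.resolvent_nonneg ha (DegPar.mulL_symm _) (hw.inner_mulL_le ha)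
      (DegPar.inner_mulL_abs _) hh hJ (mem_Ici.mp hx)
  obtain ⟨y, hy, hlim⟩ := hT.exists_tendsto hG v₀
  obtain ⟨c, hc⟩ := hw.eq_smul_of_mem_kernel ha hy
  -- `W` is fixed by the symmetric semigroup, so pairing with it is conserved along the orbit.
  have hinner : inner ℝ y W = inner ℝ v₀ W := by
    refine tendsto_nhds_unique (hlim.inner tendsto_const_nhds) ?_
    refine tendsto_const_nhds.congr' ?_
    filter_upwards [Filter.eventually_ge_atTop 0] with t ht
    rw [hT.symm, hT.apply_of_mem_kernel (hw.mem_degGraph ha) ht]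
  have hcpos : 0 < c := by
    have h1 := hw.inner_pos hv₀ hv₀_ne
    rw [← hW, ← hinner, hc, ← hW, inner_smul_left, real_inner_self_eq_norm_sq] at h1
    exact pos_of_mul_pos_left h1 (sq_nonneg _)
  -- The factor `c` in the tolerance compensates the later division by `c`.
  obtain ⟨τ, hτ, hτc⟩ : ∃ τ : ℝ, 0 < τ ∧ ‖T τ v₀ - c • W‖ ≤ c * (ε / 2) := by
    rw [hc, ← hW] at hlim
    have h1 := (Metric.tendsto_nhds.mp hlim (c * (ε / 2)) (by positivity)).and
      (Filter.eventually_gt_atTop 0)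
    obtain ⟨τ, h2, h3⟩ := h1.exists
    rw [dist_eq_norm] at h2
    exact ⟨τ, h3, h2.le⟩
  -- The semigroup does not involve `δ`, so the shift may be chosen after `τ`.
  set δ := -Real.log c / τ with hδ
  have hexp : Real.exp (δ * τ) = c⁻¹ := by
    rw [hδ, div_mul_cancel₀ _ hτ.ne', Real.exp_neg, Real.exp_log hcpos]
  refine ⟨τ, hτ, fun x => DegPar.potential a w x + δ, hw.memLp_potential_add ha δ,
    fun t => Real.exp (δ * t) • T t v₀, fun S hS => ⟨hw.isWeakSolution ha hT δ v₀ hS,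
      fun u hu => hw.weakSolution_unique ha hS hu (hw.isWeakSolution ha hT δ v₀ hS)⟩, ?_,
    fun t _ => DegPar.smul_nonneg_L2 (Real.exp_pos _).le (hTnn t)⟩
  have h1 : Real.exp (δ * τ) • T τ v₀ - W = c⁻¹ • (T τ v₀ - c • W) := by
    rw [hexp, smul_sub, smul_smul, inv_mul_cancel₀ hcpos.ne', one_smul]
  have h2 : ‖Real.exp (δ * τ) • T τ v₀ - W‖ ≤ ε / 2 := by
    rw [h1, norm_smul, Real.norm_of_nonneg (inv_pos.mpr hcpos).le, inv_mul_le_iff₀ hcpos]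
    exact hτc
  have h3 := norm_sub_le_norm_sub_add_norm_sub (Real.exp (δ * τ) • T τ v₀) W vd
  simp only
  linarith
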